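/- Minimum-power channel allocation (MPCA) with linear rate functions: given $M$ users and $N \ge M$ channels, slopes $\ell_{mn}\ge 0$ and rate targets $R_m>0$, find pairwise disjoint channel sets $\mathcal N_1,\dots,\mathcal N_M\subseteq\{1,\dots,N\}$ and powers $P_{mn}\ge 0$ ($n\in\mathcal N_m$) with $\sum_{n\in\mathcal N_m}\ell_{mn}P_{mn}\ge R_m$ for every user $m$, such that the total power $\sum_m\sum_{n\in\mathcal N_m}P_{mn}$ is minimum. **Theorem.** (a) For rational data (encoded by numerators and denominators in binary), this problem is solvable in polynomial time: one program for a random access machine with logarithmic (bit) cost outputs, for every instance, an optimal solution, or reports that no feasible solution exists, within a time that is polynomial in the bit length of the instance. (b) For arbitrary real data: for every feasible solution $((\mathcal N_m),(P_{mn}))$ the sets $\mathcal N_m$ are non-empty, and if each user $m$ instead uses only one channel $\sigma(m)\in\mathcal N_m$ with $\ell_{m\sigma(m)}=\max_{n\in\mathcal N_m}\ell_{mn}$, with power $R_m/\ell_{m\sigma(m)}$, then the solution is still feasible and no user spends more power. If the instance is feasible, there is an optimal solution in which every user uses a single channel. (c) For arbitrary real data, the problem is equivalent to the minimum-cost assignment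 problem between the $M$ users together with $N-M$ artificial users and the $N$ channels, in which assigning user $m$ to channel $n$ costs $R_m/\ell_{mn}$ (the edge is absent, i.e. the cost is $\infty$, if $\ell_{mn}=0$), and artificial users cost $0$: the instance is feasible if and only if there is an assignment of finite cost; an assignment is one of minimum, finite cost if and only if giving each user $m$ only its assigned channel $n$, with power $R_m/\ell_{mn}$, is optimal; and the minimum total power of a feasible instance equals the minimum cost of an assignment. -/

import Mathlib

open scoped ENNReal

/-! ### Minimum-power channel allocation -/

/-- The data of a minimum-power channel allocation problem with `M` users and `N` channels:
`rate m n P` is the rate that user `m` obtains on channel `n` with transmission power `P`, and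
`target m` is the rate that user `m` requires. -/
structure MPCA (M N : ℕ) where
  rate : Fin M → Fin N → ℝ → ℝ
  target : Fin M → ℝ

/-- A candidate solution: the set of channels given to each user, and the transmission powers
(only the powers `power m n` with `n ∈ chan m` matter). -/
structure Allocation (M N : ℕ) where
  chan : Fin M → Finset (Fin N)
  power : Fin M → Fin N → ℝ

/-- The power spent by user `m`. -/
noncomputable def Allocation.userPower {M N : ℕ} (a : Allocation M N) (m : Fin M) : ℝ :=
  ∑ n ∈ a.chan m, a.power m n

/-- The total power, which is to be minimized. -/
noncomputable def Allocation.totalPower {M N : ℕ} (a : Allocation M N) : ℝ :=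
  ∑ m, a.userPower m

/-- Users do not share channels, powers are nonnegative, and all rate targets are met. -/
structure MPCA.IsFeasible {M N : ℕ} (I : MPCA M N) (a : Allocation M N) : Prop where
  disjoint : ∀ m₁ m₂, m₁ ≠ m₂ → Disjoint (a.chan m₁) (a.chan m₂)
  power_nonneg : ∀ m, ∀ n ∈ a.chan m, 0 ≤ a.power m n
  target_le : ∀ m, I.target m ≤ ∑ n ∈ a.chan m, I.rate m n (a.power m n)

/-- A feasible allocation of minimum total power. -/
def MPCA.IsOptimal {M N : ℕ} (I : MPCA M N) (a : Allocation M N) : Prop :=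
  I.IsFeasible a ∧ ∀ b, I.IsFeasible b → a.totalPower ≤ b.totalPower

/-- The problem with the linear rate functions `P ↦ ℓ m n * P` and rate targets `R m`. -/
noncomputable def linearMPCA {M N : ℕ} (ℓ : Fin M → Fin N → ℝ) (R : Fin M → ℝ) : MPCA M N where
  rate := fun m n P => ℓ m n * P
  target := R

/-- User `m` uses the single channel `σ m`, with power `R m / ℓ m (σ m)`. (If `ℓ m (σ m) = 0`
and `0 < R m`, this allocation is not feasible.) -/
noncomputable def singleChannel {M N : ℕ} (ℓ : Fin M → Fin N → ℝ) (R : Fin M → ℝ)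
    (σ : Fin M → Fin N) : Allocation M N where
  chan := fun m => {σ m}
  power := fun m n => R m / ℓ m n

/-! ### Minimum-cost bipartite assignment -/

/-- The cost of the perfect matching `π` between `N` rows and `N` columns; a pair of cost `∞` is
a missing edge. -/
noncomputable def matchingCost {N : ℕ} (c : Fin N → Fin N → ℝ≥0∞) (π : Equiv.Perm (Fin N)) :
    ℝ≥0∞ :=
  ∑ i, c i (π i)

/-- `π` is a minimum-cost assignment: a perfect matching that uses existing edges only and whose
cost is minimum. -/
def IsMinCostAssignment {N : ℕ} (c : Fin N → Fin N → ℝ≥0∞) (π : Equiv.Perm (Fin N)) : Prop :=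
  matchingCost c π < ∞ ∧ ∀ π', matchingCost c π ≤ matchingCost c π'

/-- The assignment problem of a linear instance: the `M` users are followed by `N - M` artificial
users; matching user `m` with channel `n` costs `R m / ℓ m n` (which is `∞` if `ℓ m n = 0`, as
`0 < R m`), and matching an artificial user costs nothing. -/
noncomputable def assignmentCost {M N : ℕ} (ℓ : Fin M → Fin N → ℝ) (R : Fin M → ℝ)
    (i n : Fin N) : ℝ≥0∞ :=
  if h : i.val < M then ENNReal.ofReal (R ⟨i, h⟩) / ENNReal.ofReal (ℓ ⟨i, h⟩ n) else 0

/-! ### Random access machines with logarithmic cost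

Programs are structured programs over finitely many variables and finitely many arrays that hold
natural numbers of arbitrary size. Every value that is produced is charged its bit length plus
one, so a polynomial bound on the cost is polynomial time in the usual (Turing machine) sense. -/

namespace Ram

/-- Binary operations; subtraction is truncated, division is rounded down. -/
inductive Op where
  | add
  | sub
  | mul
  | div

def Op.apply : Op → ℕ → ℕ → ℕ
  | .add, x, y => x + y
  | .sub, x, y => x - y
  | .mul, x, y => x * y
  | .div, x, y => x / y

/-- Expressions: constants, variables, array cells, binary operations. -/
inductive Expr where
  | const (k : ℕ)
  | var (x : ℕ)
  | get (A : ℕ) (i : Expr)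
  | op (o : Op) (e₁ e₂ : Expr)

/-- Programs. The names of variables and arrays are fixed in the text of the program; array
indices are computed. `emit` appends a number to the output. A condition holds if its value is
not `0`. -/
inductive Prog where
  | skip
  | assign (x : ℕ) (e : Expr)
  | store (A : ℕ) (i e : Expr)
  | emit (e : Expr)
  | seq (p q : Prog)
  | ite (e : Expr) (p q : Prog)
  | loop (e : Expr) (p : Prog)

structure State where
  vars : ℕ → ℕ
  arrays : ℕ → ℕ → ℕ
  output : List ℕ

def State.setVar (s : State) (x v : ℕ) : State where
  vars := Function.update s.vars x v
  arrays := s.arrays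
  output := s.output

def State.setCell (s : State) (A i v : ℕ) : State where
  vars := s.vars
  arrays := Function.update s.arrays A (Function.update (s.arrays A) i v)
  output := s.output

def State.emit (s : State) (v : ℕ) : State where
  vars := s.vars
  arrays := s.arrays
  output := s.output ++ [v]

def Expr.val (s : State) : Expr → ℕ
  | .const k => k
  | .var x => s.vars x
  | .get A i => s.arrays A (i.val s)
  | .op o e₁ e₂ => o.apply (e₁.val s) (e₂.val s)

/-- The cost of evaluating an expression: one plus the bit length of the value, for each of its
subexpressions. In particular array indices and operands are charged. -/
def Expr.cost (s : State) : Expr → ℕ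
  | .const k => 1 + Nat.size k
  | .var x => 1 + Nat.size (s.vars x)
  | .get A i => i.cost s + (1 + Nat.size ((Expr.get A i).val s))
  | .op o e₁ e₂ => e₁.cost s + e₂.cost s + (1 + Nat.size ((Expr.op o e₁ e₂).val s))

/-- `Exec p s s' t`: started in state `s`, the program `p` halts in state `s'` at total
cost `t`. -/
inductive Exec : Prog → State → State → ℕ → Prop where
  | skip (s : State) : Exec .skip s s 1
  | assign (s : State) (x : ℕ) (e : Expr) :
      Exec (.assign x e) s (s.setVar x (e.val s)) (1 + e.cost s)
  | store (s : State) (A : ℕ) (i e : Expr) :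
      Exec (.store A i e) s (s.setCell A (i.val s) (e.val s)) (1 + i.cost s + e.cost s)
  | emit (s : State) (e : Expr) :
      Exec (.emit e) s (s.emit (e.val s)) (1 + e.cost s)
  | seq {p q : Prog} {s s' s'' : State} {t t' : ℕ} :
      Exec p s s' t → Exec q s' s'' t' → Exec (.seq p q) s s'' (t + t')
  | ite_true {e : Expr} {p q : Prog} {s s' : State} {t : ℕ} :
      e.val s ≠ 0 → Exec p s s' t → Exec (.ite e p q) s s' (1 + e.cost s + t)
  | ite_false {e : Expr} {p q : Prog} {s s' : State} {t : ℕ} :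
      e.val s = 0 → Exec q s s' t → Exec (.ite e p q) s s' (1 + e.cost s + t)
  | loop_true {e : Expr} {p : Prog} {s s' s'' : State} {t t' : ℕ} :
      e.val s ≠ 0 → Exec p s s' t → Exec (.loop e p) s' s'' t' →
      Exec (.loop e p) s s'' (1 + e.cost s + t + t')
  | loop_false {e : Expr} {p : Prog} {s : State} :
      e.val s = 0 → Exec (.loop e p) s s (1 + e.cost s)

/-- The initial state on an input: its length is in variable `0`, its entries are in array `0`,
everything else is zero, and the output is empty. -/
def start (input : List ℕ) : State where
  vars := Function.update (fun _ => 0) 0 input.length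
  arrays := Function.update (fun _ _ => 0) 0 (fun i => input.getD i 0)
  output := []

/-- The size of an input: one plus the bit length, for each of its entries. -/
def inputSize (input : List ℕ) : ℕ :=
  (input.map fun k => 1 + Nat.size k).sum

/-- A search problem, with instances `ι`, input encoding `enc` and acceptable outputs `Good i`,
is solvable in polynomial time: one program halts on every instance, with an acceptable output,
at a cost that is bounded by a polynomial in the size of the input. -/
def SolvableInPolyTime {ι : Type} (enc : ι → List ℕ) (Good : ι → List ℕ → Prop) : Prop :=
  ∃ (p : Prog) (q : Polynomial ℕ), ∀ i : ι, ∃ (s : State) (t : ℕ),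
    Exec p (start (enc i)) s t ∧ t ≤ q.eval (inputSize (enc i)) ∧ Good i s.output

end Ram

/-! ### Linear instances with rational data, and their solution by a program -/

/-- Numerical instances with linear rate functions: `M ≤ N`, rational slopes `ℓ m n ≥ 0` and
rational rate targets `R m > 0`. -/
structure LinearInstance where
  M : ℕ
  N : ℕ
  le : M ≤ N
  ℓ : Fin M → Fin N → ℚ≥0
  R : Fin M → ℚ≥0
  R_pos : ∀ m, 0 < R m

noncomputable def LinearInstance.toMPCA (I : LinearInstance) : MPCA I.M I.N :=
  linearMPCA (fun m n => (I.ℓ m n : ℝ)) (fun m => (I.R m : ℝ))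

/-- The input: `M`, `N`, the slopes row by row, the rate targets; fractions are in lowest terms,
numerator first. -/
def LinearInstance.encode (I : LinearInstance) : List ℕ :=
  [I.M, I.N]
    ++ (List.finRange I.M).flatMap (fun m =>
        (List.finRange I.N).flatMap fun n => [(I.ℓ m n).num, (I.ℓ m n).den])
    ++ (List.finRange I.M).flatMap (fun m => [(I.R m).num, (I.R m).den])

/-- The output that describes the allocation with channel sets `chan` and powers
`num m n / den m n`: first a `1`, then row by row, for each user `m` and channel `n`, whether `m`
gets `n`, and the numerator and the denominator of the power. -/
def encodeAllocation {M N : ℕ} (chan : Fin M → Finset (Fin N)) (num den : Fin M → Fin N → ℕ) :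
    List ℕ :=
  1 :: (List.finRange M).flatMap fun m =>
    (List.finRange N).flatMap fun n => [if n ∈ chan m then 1 else 0, num m n, den m n]

/-- A correct answer: a description of an optimal allocation, or the answer `0` if no allocation
is feasible. -/
def LinearInstance.IsAnswer (I : LinearInstance) (out : List ℕ) : Prop :=
  (∃ (chan : Fin I.M → Finset (Fin I.N)) (num den : Fin I.M → Fin I.N → ℕ),
      (∀ m n, 0 < den m n) ∧ out = encodeAllocation chan num den ∧
      I.toMPCA.IsOptimal ⟨chan, fun m n => (num m n : ℝ) / (den m n : ℝ)⟩) ∨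
    ((¬ ∃ a, I.toMPCA.IsFeasible a) ∧ out = [0])

/-! For (b): with linear rates, a unit of power is worth most on a channel of largest slope. If `ℓ m
n` is the largest slope among the channels of user `m`, then `R m ≤ ℓ m n * userPower m`
(`MPCA.IsFeasible.target_le_mul`), so channel `n` alone, with power `R m / ℓ m n`, is enough and
costs no more. Hence only single-channel allocations compete. The feasible ones are the injections
of users into channels along positive slopes, finitely many, so an optimum exists as soon as one of
them does.

For (c): such an injection extends to a permutation in which the artificial users take the remaining
channels at no cost (`exists_perm_extending`). Finite matching cost means that no zero slope is
used, and then the cost is the total power.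

For (a): let `D` be the product of all nonzero input entries. Multiplied by `D`, the costs of
present edges become natural numbers of size at most `D ^ 2`; a missing edge gets weight `2 * D ^
3`, more than `M` present edges together, so a minimum matching uses one only if the instance is
infeasible (`not_exists_isFeasible`). The matching is computed by the Hungarian method. Each phase
enters one row, grows an alternating tree of tight edges by shifting the dual solution by the
minimum slack (`Holed.dualStep`, `Tree.extend`) until a free column is reached, and then shifts the
matching along the tree path (`Aug.step`). The final dual solution certifies minimality
(`Holed.isMin`).

Running time is split into a count of steps and a bound on bit lengths. If every stored product has
an input entry as a factor, a step lengthens the stored numbers by a bounded amount only, so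
polynomially many steps have polynomial bit cost (`Run.exec`). Steps and correctness are handled
together by the rules for `Tot`. -/

namespace Ram

/-! ### Unit-cost execution -/

/-- `Run p s s' k`: started in `s`, the program `p` halts in `s'` after `k` elementary steps. -/
inductive Run : Prog → State → State → ℕ → Prop where
  | skip (s : State) : Run .skip s s 1
  | assign (s : State) (x : ℕ) (e : Expr) : Run (.assign x e) s (s.setVar x (e.val s)) 1
  | store (s : State) (A : ℕ) (i e : Expr) :
      Run (.store A i e) s (s.setCell A (i.val s) (e.val s)) 1
  | emit (s : State) (e : Expr) : Run (.emit e) s (s.emit (e.val s)) 1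
  | seq {p q : Prog} {s s' s'' : State} {k k' : ℕ} :
      Run p s s' k → Run q s' s'' k' → Run (.seq p q) s s'' (k + k')
  | ite_true {e : Expr} {p q : Prog} {s s' : State} {k : ℕ} :
      e.val s ≠ 0 → Run p s s' k → Run (.ite e p q) s s' (1 + k)
  | ite_false {e : Expr} {p q : Prog} {s s' : State} {k : ℕ} :
      e.val s = 0 → Run q s s' k → Run (.ite e p q) s s' (1 + k)
  | loop_true {e : Expr} {p : Prog} {s s' s'' : State} {k k' : ℕ} :
      e.val s ≠ 0 → Run p s s' k → Run (.loop e p) s' s'' k' →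
      Run (.loop e p) s s'' (1 + k + k')
  | loop_false {e : Expr} {p : Prog} {s : State} :
      e.val s = 0 → Run (.loop e p) s s 1

/-- The length of an expression, which also counts the bits of its constants. -/
def Expr.len : Expr → ℕ
  | .const k => 1 + Nat.size k
  | .var _ => 1
  | .get _ i => 1 + i.len
  | .op _ e₁ e₂ => 1 + e₁.len + e₂.len

/-- The length of a program. -/
def Prog.len : Prog → ℕ
  | .skip => 1
  | .assign _ e => 1 + e.len
  | .store _ i e => 1 + i.len + e.len
  | .emit e => 1 + e.len
  | .seq p q => p.len + q.len
  | .ite e p q => 1 + e.len + p.len + q.len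
  | .loop e p => 1 + e.len + p.len

/-- The expression reads a cell of the input array. -/
def Expr.isInput : Expr → Bool
  | .get 0 _ => true
  | _ => false

/-- The bit length of the value exceeds that of the values in the state by a bounded amount only:
products have a factor that is read from the input array. -/
def Expr.mild : Expr → Bool
  | .const _ => true
  | .var _ => true
  | .get _ _ => true
  | .op .add e₁ e₂ => e₁.mild && e₂.mild
  | .op .sub e₁ _ => e₁.mild
  | .op .div e₁ _ => e₁.mild
  | .op .mul e₁ e₂ => e₁.mild && e₂.isInput

/-- All values that the program stores are given by mild expressions, and the input array is not
written to. -/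
def Prog.mild : Prog → Bool
  | .skip => true
  | .assign _ e => e.mild
  | .store A _ e => (A != 0) && e.mild
  | .emit _ => true
  | .seq p q => p.mild && q.mild
  | .ite _ p q => p.mild && q.mild
  | .loop _ p => p.mild

/-- The bit lengths of all values in the state are at most `b`. -/
structure State.SizeLE (s : State) (b : ℕ) : Prop where
  vars : ∀ x, (s.vars x).size ≤ b
  arrays : ∀ A i, (s.arrays A i).size ≤ b

/-! ### Growth of bit lengths, and the passage from steps to bit cost. -/

theorem size_add_le (x y : ℕ) : (x + y).size ≤ max x.size y.size + 1 := by
  rw [Nat.size_le, pow_succ]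
  have hx := Nat.lt_size_self x
  have hy := Nat.lt_size_self y
  have h₁ : 2 ^ x.size ≤ 2 ^ max x.size y.size := Nat.pow_le_pow_right (by norm_num) (le_max_left _ _)
  have h₂ : 2 ^ y.size ≤ 2 ^ max x.size y.size := Nat.pow_le_pow_right (by norm_num) (le_max_right _ _)
  omega

theorem size_mul_le (x y : ℕ) : (x * y).size ≤ x.size + y.size := by
  rw [Nat.size_le, pow_add]
  exact Nat.mul_lt_mul'' (Nat.lt_size_self x) (Nat.lt_size_self y)

theorem Op.size_apply_le (o : Op) (x y : ℕ) : (o.apply x y).size ≤ x.size + y.size + 1 := by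
  cases o
  · exact (size_add_le x y).trans (by omega)
  · exact (Nat.size_le_size (Nat.sub_le x y)).trans (by omega)
  · exact (size_mul_le x y).trans (by omega)
  · exact (Nat.size_le_size (Nat.div_le_self x y)).trans (by omega)

/-- An operation at most adds the bit lengths of its operands, plus one. The factor in front of `b`
is harmless for costs, and for indices, conditions and emitted values, which are never fed back into
the state. -/
theorem Expr.size_val_le {s : State} {b : ℕ} (h : s.SizeLE b) (e : Expr) :
    (e.val s).size ≤ e.len * (b + 1) := by
  induction e with
  | const k => simp only [Expr.val, Expr.len]; nlinarith
  | var x => simpa [Expr.val, Expr.len] using (h.vars x).trans (by omega)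
  | get A i ih => simp only [Expr.val, Expr.len]; nlinarith [h.arrays A (i.val s)]
  | op o e₁ e₂ ih₁ ih₂ =>
    simp only [Expr.val, Expr.len]
    nlinarith [o.size_apply_le (e₁.val s) (e₂.val s)]

/-- `L` is kept apart from `e.len` so that, in the induction, all subexpressions share one bound for
their values. -/
theorem Expr.cost_le {s : State} {b : ℕ} (h : s.SizeLE b) {e : Expr} {L : ℕ} (hL : e.len ≤ L) :
    e.cost s ≤ e.len * (1 + L * (b + 1)) := by
  have key : ∀ e' : Expr, e'.len ≤ L → 1 + (e'.val s).size ≤ 1 + L * (b + 1) := fun e' h' =>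
    Nat.add_le_add_left ((e'.size_val_le h).trans (Nat.mul_le_mul_right _ h')) 1
  induction e with
  | const k =>
    have h₁ := key (.const k) hL
    simp only [Expr.val] at h₁
    simp only [Expr.cost, Expr.len]
    nlinarith
  | var x =>
    have h₁ := key (.var x) hL
    simp only [Expr.val] at h₁
    simpa only [Expr.cost, Expr.len, one_mul] using h₁
  | get A i ih =>
    have h₁ := key (.get A i) hL
    simp only [Expr.len] at hL
    have h₂ := ih (by omega)
    simp only [Expr.cost, Expr.len]
    nlinarith
  | op o e₁ e₂ ih₁ ih₂ =>
    have h₁ := key (.op o e₁ e₂) hL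
    simp only [Expr.len] at hL
    have h₂ := ih₁ (by omega)
    have h₃ := ih₂ (by omega)
    simp only [Expr.cost, Expr.len]
    nlinarith

/-- Here `b` has coefficient one, so the bound can be iterated: repeated assignments lead to linear
growth. An unrestricted product could double the bit length at every step. -/
theorem Expr.size_val_le_of_mild {s : State} {b b₀ : ℕ} (h : s.SizeLE b)
    (h₀ : ∀ i, (s.arrays 0 i).size ≤ b₀) (e : Expr) (he : e.mild = true) :
    (e.val s).size ≤ b + e.len * (b₀ + 1) := by
  induction e with
  | const k => simp only [Expr.val, Expr.len]; nlinarith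
  | var x => simpa only [Expr.val] using (h.vars x).trans (by omega)
  | get A i ih => simpa only [Expr.val] using (h.arrays A _).trans (by omega)
  | op o e₁ e₂ ih₁ ih₂ =>
    simp only [Expr.val, Expr.len]
    cases o with
    | add =>
      simp only [Expr.mild, Bool.and_eq_true] at he
      have h₁ := ih₁ he.1
      have h₂ := ih₂ he.2
      refine (size_add_le _ _).trans ?_
      have : max (e₁.val s).size (e₂.val s).size ≤ b + (e₁.len + e₂.len) * (b₀ + 1) :=
        max_le (by nlinarith) (by nlinarith)
      nlinarith
    | sub =>
      simp only [Expr.mild] at he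
      have h₁ := ih₁ he
      refine (Nat.size_le_size (Nat.sub_le _ _)).trans ?_
      nlinarith
    | div =>
      simp only [Expr.mild] at he
      have h₁ := ih₁ he
      refine (Nat.size_le_size (Nat.div_le_self _ _)).trans ?_
      nlinarith
    | mul =>
      simp only [Expr.mild, Bool.and_eq_true] at he
      have h₁ := ih₁ he.1
      have h₂ : (e₂.val s).size ≤ b₀ := by
        have := he.2
        match e₂, this with
        | .get 0 i, _ => exact h₀ _
      refine (size_mul_le _ _).trans ?_
      nlinarith

theorem State.SizeLE.mono {s : State} {b b' : ℕ} (h : s.SizeLE b) (hb : b ≤ b') : s.SizeLE b' :=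
  ⟨fun x => (h.vars x).trans hb, fun A i => (h.arrays A i).trans hb⟩

theorem State.SizeLE.setVar {s : State} {b : ℕ} (h : s.SizeLE b) {x v : ℕ} (hv : v.size ≤ b) :
    (s.setVar x v).SizeLE b := by
  refine ⟨fun y => ?_, h.arrays⟩
  by_cases hy : y = x
  · subst hy; simpa [State.setVar] using hv
  · simpa [State.setVar, hy] using h.vars y

theorem State.SizeLE.setCell {s : State} {b : ℕ} (h : s.SizeLE b) {A i v : ℕ} (hv : v.size ≤ b) :
    (s.setCell A i v).SizeLE b := by
  refine ⟨h.vars, fun B j => ?_⟩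
  by_cases hB : B = A
  · subst hB
    by_cases hj : j = i
    · subst hj; simpa [State.setCell] using hv
    · simpa [State.setCell, hj] using h.arrays B j
  · simpa [State.setCell, hB] using h.arrays B j

/-- The cost of `k` steps of a mild program of length at most `L`, if all values have bit length
at most `b` before the last step. -/
def costBound (L b k : ℕ) : ℕ := k * (1 + L * (1 + L * (b + 1)))

theorem costBound_add_le {L b b' k k' t t' : ℕ} (hb : b ≤ b') (ht : t ≤ costBound L b k)
    (ht' : t' ≤ costBound L b' k') : t + t' ≤ costBound L b' (k + k') := by
  have : costBound L b k ≤ costBound L b' k := by unfold costBound; gcongr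
  unfold costBound at *
  linarith [add_mul k k' (1 + L * (1 + L * (b' + 1)))]

theorem le_costBound_one {L b c l : ℕ} (hl : l ≤ L) (hc : c ≤ l * (1 + L * (b + 1))) :
    1 + c ≤ costBound L b 1 := by
  have : l * (1 + L * (b + 1)) ≤ L * (1 + L * (b + 1)) := Nat.mul_le_mul_right _ hl
  unfold costBound
  omega

/-- A mild program is executed at a cost that is polynomial in the number of steps and the bit
lengths of the values in the initial state. -/
theorem Run.exec {p : Prog} {s s' : State} {k : ℕ} (h : Run p s s' k) {L b₀ : ℕ} :
    ∀ {b : ℕ}, p.mild = true → p.len ≤ L → s.SizeLE b → (∀ i, (s.arrays 0 i).size ≤ b₀) →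
      s'.SizeLE (b + k * (L * (b₀ + 1))) ∧ (∀ i, (s'.arrays 0 i).size ≤ b₀) ∧
      ∃ t, Exec p s s' t ∧ t ≤ costBound L (b + k * (L * (b₀ + 1))) k := by
  induction h with
  | skip s =>
    intro b _ _ hs h₀
    refine ⟨hs.mono (by omega), h₀, 1, .skip s, ?_⟩
    unfold costBound; omega
  | assign s x e =>
    intro b hp hL hs h₀
    simp only [Prog.len, Prog.mild] at hL hp
    have hv : (e.val s).size ≤ b + 1 * (L * (b₀ + 1)) := by
      refine (e.size_val_le_of_mild hs h₀ hp).trans ?_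
      rw [one_mul]
      gcongr
      omega
    refine ⟨(hs.mono (by omega)).setVar hv, h₀, _, .assign s x e, ?_⟩
    exact le_costBound_one (by omega : e.len ≤ L) (Expr.cost_le (hs.mono (by omega)) (by omega))
  | store s A i e =>
    intro b hp hL hs h₀
    simp only [Prog.len, Prog.mild, Bool.and_eq_true, bne_iff_ne] at hL hp
    have hv : (e.val s).size ≤ b + 1 * (L * (b₀ + 1)) := by
      refine (e.size_val_le_of_mild hs h₀ hp.2).trans ?_
      rw [one_mul]
      gcongr
      omega
    refine ⟨(hs.mono (by omega)).setCell hv, fun j => ?_, _, .store s A i e, ?_⟩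
    · simpa [State.setCell, Function.update_of_ne hp.1.symm] using h₀ j
    · have h₁ := Expr.cost_le (L := L) (hs.mono (by omega : b ≤ b + 1 * (L * (b₀ + 1))))
        (e := i) (by omega)
      have h₂ := Expr.cost_le (L := L) (hs.mono (by omega : b ≤ b + 1 * (L * (b₀ + 1))))
        (e := e) (by omega)
      rw [add_assoc]
      refine le_costBound_one (by omega : i.len + e.len ≤ L) ?_
      rw [add_mul]
      exact Nat.add_le_add h₁ h₂
  | emit s e =>
    intro b hp hL hs h₀
    simp only [Prog.len] at hL
    refine ⟨⟨(hs.mono (by omega)).vars, (hs.mono (by omega)).arrays⟩, h₀, _, .emit s e, ?_⟩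
    exact le_costBound_one (by omega : e.len ≤ L) (Expr.cost_le (hs.mono (by omega)) (by omega))
  | @seq p q s s' s'' k k' _ _ ih₁ ih₂ =>
    intro b hp hL hs h₀
    simp only [Prog.len, Prog.mild, Bool.and_eq_true] at hL hp
    obtain ⟨hs', h₀', t, ht, htb⟩ := ih₁ hp.1 (by omega) hs h₀
    obtain ⟨hs'', h₀'', t', ht', htb'⟩ := ih₂ hp.2 (by omega) hs' h₀'
    have e₁ : b + k * (L * (b₀ + 1)) + k' * (L * (b₀ + 1)) = b + (k + k') * (L * (b₀ + 1)) := by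
      ring
    rw [e₁] at hs'' htb'
    exact ⟨hs'', h₀'', _, .seq ht ht', costBound_add_le (by rw [← e₁]; omega) htb htb'⟩
  | @ite_true e p q s s' k he _ ih =>
    intro b hp hL hs h₀
    simp only [Prog.len, Prog.mild, Bool.and_eq_true] at hL hp
    obtain ⟨hs', h₀', t, ht, htb⟩ := ih hp.1 (by omega) hs h₀
    have hle : b + k * (L * (b₀ + 1)) ≤ b + (1 + k) * (L * (b₀ + 1)) := by gcongr; omega
    refine ⟨hs'.mono hle, h₀', _, .ite_true he ht, ?_⟩
    refine costBound_add_le (le_refl _) (le_costBound_one (by omega : e.len ≤ L)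
      (Expr.cost_le (hs.mono (by omega)) (by omega))) (htb.trans ?_)
    unfold costBound; gcongr
  | @ite_false e p q s s' k he _ ih =>
    intro b hp hL hs h₀
    simp only [Prog.len, Prog.mild, Bool.and_eq_true] at hL hp
    obtain ⟨hs', h₀', t, ht, htb⟩ := ih hp.2 (by omega) hs h₀
    have hle : b + k * (L * (b₀ + 1)) ≤ b + (1 + k) * (L * (b₀ + 1)) := by gcongr; omega
    refine ⟨hs'.mono hle, h₀', _, .ite_false he ht, ?_⟩
    refine costBound_add_le (le_refl _) (le_costBound_one (by omega : e.len ≤ L)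
      (Expr.cost_le (hs.mono (by omega)) (by omega))) (htb.trans ?_)
    unfold costBound; gcongr
  | @loop_true e p s s' s'' k k' he _ _ ih₁ ih₂ =>
    intro b hp hL hs h₀
    have hL' := hL
    have hp' := hp
    simp only [Prog.len, Prog.mild] at hL hp
    obtain ⟨hs', h₀', t, ht, htb⟩ := ih₁ hp (by omega) hs h₀
    obtain ⟨hs'', h₀'', t', ht', htb'⟩ := ih₂ hp' hL' hs' h₀'
    have e₁ : b + k * (L * (b₀ + 1)) + k' * (L * (b₀ + 1)) = b + (k + k') * (L * (b₀ + 1)) := by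
      ring
    rw [e₁] at hs'' htb'
    have hle : b + (k + k') * (L * (b₀ + 1)) ≤ b + (1 + k + k') * (L * (b₀ + 1)) := by
      gcongr; omega
    refine ⟨hs''.mono hle, h₀'', _, .loop_true he ht ht', ?_⟩
    have hle' : b + k * (L * (b₀ + 1)) ≤ b + (1 + k + k') * (L * (b₀ + 1)) := by gcongr; omega
    refine costBound_add_le (le_refl _) (costBound_add_le hle' (b := b + k * (L * (b₀ + 1)))
      (k := 1) ?_ (htb.trans ?_)) (htb'.trans ?_)
    · exact le_costBound_one (by omega : e.len ≤ L) (Expr.cost_le (hs.mono (by omega)) (by omega))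
    · unfold costBound; gcongr
    · unfold costBound; gcongr
  | @loop_false e p s he =>
    intro b hp hL hs h₀
    simp only [Prog.len] at hL
    refine ⟨hs.mono (by omega), h₀, _, .loop_false he, ?_⟩
    exact le_costBound_one (by omega : e.len ≤ L) (Expr.cost_le (hs.mono (by omega)) (by omega))

/-! ### Frames -/

/-- The program assigns to the variable `x`. -/
def Prog.setsVar (x : ℕ) : Prog → Bool
  | .assign y _ => y == x
  | .seq p q => p.setsVar x || q.setsVar x
  | .ite _ p q => p.setsVar x || q.setsVar x
  | .loop _ p => p.setsVar x
  | _ => false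

/-- The program writes to the array `A`. -/
def Prog.setsArray (A : ℕ) : Prog → Bool
  | .store B _ _ => B == A
  | .seq p q => p.setsArray A || q.setsArray A
  | .ite _ p q => p.setsArray A || q.setsArray A
  | .loop _ p => p.setsArray A
  | _ => false

/-- The program extends the output. -/
def Prog.emits : Prog → Bool
  | .emit _ => true
  | .seq p q => p.emits || q.emits
  | .ite _ p q => p.emits || q.emits
  | .loop _ p => p.emits
  | _ => false

/-- `s'` differs from `s` only in what the program `p` may change. -/
structure Frame (p : Prog) (s s' : State) : Prop where
  vars : ∀ x, p.setsVar x = false → s'.vars x = s.vars x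
  arrays : ∀ A, p.setsArray A = false → s'.arrays A = s.arrays A
  output : p.emits = false → s'.output = s.output

theorem Frame.refl (p : Prog) (s : State) : Frame p s s :=
  ⟨fun _ _ => rfl, fun _ _ => rfl, fun _ => rfl⟩

theorem Frame.trans {p : Prog} {s s' s'' : State} (h : Frame p s s') (h' : Frame p s' s'') :
    Frame p s s'' :=
  ⟨fun x hx => (h'.vars x hx).trans (h.vars x hx),
    fun A hA => (h'.arrays A hA).trans (h.arrays A hA),
    fun ho => (h'.output ho).trans (h.output ho)⟩

theorem Frame.mono {p q : Prog} {s s' : State} (h : Frame p s s')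
    (hv : ∀ x, q.setsVar x = false → p.setsVar x = false)
    (ha : ∀ A, q.setsArray A = false → p.setsArray A = false)
    (ho : q.emits = false → p.emits = false) : Frame q s s' :=
  ⟨fun x hx => h.vars x (hv x hx), fun A hA => h.arrays A (ha A hA), fun h' => h.output (ho h')⟩

/-- What a program leaves unchanged is read off from its text; for concrete programs `decide`
settles it. -/
theorem Run.frame {p : Prog} {s s' : State} {k : ℕ} (h : Run p s s' k) : Frame p s s' := by
  induction h with
  | skip s => exact Frame.refl _ _
  | assign s x e =>
    refine ⟨fun y hy => ?_, fun _ _ => rfl, fun _ => rfl⟩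
    have : y ≠ x := fun h => by simp [Prog.setsVar, h] at hy
    simp [State.setVar, this]
  | store s A i e =>
    refine ⟨fun _ _ => rfl, fun B hB => ?_, fun _ => rfl⟩
    have : B ≠ A := fun h => by simp [Prog.setsArray, h] at hB
    simp [State.setCell, this]
  | emit s e => exact ⟨fun _ _ => rfl, fun _ _ => rfl, fun h => by simp [Prog.emits] at h⟩
  | seq _ _ ih₁ ih₂ =>
    refine Frame.trans (ih₁.mono ?_ ?_ ?_) (ih₂.mono ?_ ?_ ?_) <;>
      simp +contextual [Prog.setsVar, Prog.setsArray, Prog.emits]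
  | ite_true _ _ ih =>
    refine ih.mono ?_ ?_ ?_ <;> simp +contextual [Prog.setsVar, Prog.setsArray, Prog.emits]
  | ite_false _ _ ih =>
    refine ih.mono ?_ ?_ ?_ <;> simp +contextual [Prog.setsVar, Prog.setsArray, Prog.emits]
  | loop_true _ _ _ ih₁ ih₂ =>
    refine Frame.trans (ih₁.mono ?_ ?_ ?_) ih₂ <;>
      simp +contextual [Prog.setsVar, Prog.setsArray, Prog.emits]
  | loop_false _ => exact Frame.refl _ _

/-! ### Total correctness -/

/-- Started in `s`, the program `p` halts after at most `k` steps, in a state with `Q`. -/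
def Tot (p : Prog) (s : State) (k : ℕ) (Q : State → Prop) : Prop :=
  ∃ s' k', k' ≤ k ∧ Run p s s' k' ∧ Q s'

section

variable {p q : Prog} {s : State} {k k' : ℕ} {Q Q' : State → Prop}

theorem Tot.mono (h : Tot p s k Q) (hk : k ≤ k') : Tot p s k' Q := by
  obtain ⟨s', l, hl, hr, hq⟩ := h
  exact ⟨s', l, hl.trans hk, hr, hq⟩

/-- The frame comes for free, so a postcondition has to describe only what the program changes. -/
theorem Tot.imp (h : Tot p s k Q) (hQ : ∀ s', Frame p s s' → Q s' → Q' s') : Tot p s k Q' := by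
  obtain ⟨s', l, hl, hr, hq⟩ := h
  exact ⟨s', l, hl, hr, hQ s' hr.frame hq⟩

theorem Tot.skip (h : Q s) : Tot .skip s 1 Q := ⟨s, 1, le_rfl, .skip s, h⟩

theorem Tot.assign {x : ℕ} {e : Expr} (h : Q (s.setVar x (e.val s))) : Tot (.assign x e) s 1 Q :=
  ⟨_, 1, le_rfl, .assign s x e, h⟩

theorem Tot.store {A : ℕ} {i e : Expr} (h : Q (s.setCell A (i.val s) (e.val s))) :
    Tot (.store A i e) s 1 Q :=
  ⟨_, 1, le_rfl, .store s A i e, h⟩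

theorem Tot.emit {e : Expr} (h : Q (s.emit (e.val s))) : Tot (.emit e) s 1 Q :=
  ⟨_, 1, le_rfl, .emit s e, h⟩

theorem Tot.seq (h : Tot p s k fun s' => Tot q s' k' Q) : Tot (.seq p q) s (k + k') Q := by
  obtain ⟨s', l, hl, hr, s'', l', hl', hr', hq⟩ := h
  exact ⟨s'', l + l', Nat.add_le_add hl hl', .seq hr hr', hq⟩

theorem Tot.ite {e : Expr} (h₁ : e.val s ≠ 0 → Tot p s k Q) (h₂ : e.val s = 0 → Tot q s k Q) :
    Tot (.ite e p q) s (k + 1) Q := by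
  by_cases he : e.val s = 0
  · obtain ⟨s', l, hl, hr, hq⟩ := h₂ he
    exact ⟨s', 1 + l, by omega, .ite_false he hr, hq⟩
  · obtain ⟨s', l, hl, hr, hq⟩ := h₁ he
    exact ⟨s', 1 + l, by omega, .ite_true he hr, hq⟩

/-- The index of `Inv` is a variant that bounds the number of remaining iterations. The loop may
stop before it reaches zero, hence the unspecified index at the end. -/
theorem Tot.loop {e : Expr} {Inv : ℕ → State → Prop}
    (hstep : ∀ n s', Frame (.loop e p) s s' → e.val s' ≠ 0 → Inv n s' →
      0 < n ∧ Tot p s' k (Inv (n - 1)))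
    {n : ℕ} (h : Inv n s) :
    Tot (.loop e p) s (1 + n * (1 + k)) fun s' => e.val s' = 0 ∧ ∃ m, Inv m s' := by
  induction n generalizing s with
  | zero =>
    by_cases he : e.val s = 0
    · exact ⟨s, 1, by omega, .loop_false he, he, 0, h⟩
    · exact absurd (hstep 0 s (Frame.refl _ _) he h).1 (lt_irrefl 0)
  | succ n ih =>
    by_cases he : e.val s = 0
    · exact ⟨s, 1, by omega, .loop_false he, he, _, h⟩
    · obtain ⟨s', l, hl, hr, hq⟩ := (hstep _ s (Frame.refl _ _) he h).2
      have hf : Frame (.loop e p) s s' := by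
        refine hr.frame.mono ?_ ?_ ?_ <;>
          simp +contextual [Prog.setsVar, Prog.setsArray, Prog.emits]
      obtain ⟨s'', l', hl', hr', hq'⟩ := ih (fun m t ht => hstep m t (hf.trans ht)) hq
      refine ⟨s'', 1 + l + l', ?_, .loop_true he hr hr', hq'⟩
      rw [add_one_mul]
      omega

/-- `for x < e do p`; the value of `e` has to be the same in every iteration. -/
def Prog.forLt (x : ℕ) (e : Expr) (p : Prog) : Prog :=
  .seq (.assign x (.const 0)) <| .loop (.op .sub e (.var x)) <|
    .seq p (.assign x (.op .add (.var x) (.const 1)))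

theorem Tot.forLt {x : ℕ} {e : Expr} {Inv : ℕ → State → Prop} {n : ℕ}
    (hx : p.setsVar x = false) (he : ∀ s', Frame (.forLt x e p) s s' → e.val s' = n)
    (h₀ : Inv 0 (s.setVar x 0))
    (hstep : ∀ i < n, ∀ s', Frame (.forLt x e p) s s' → s'.vars x = i → Inv i s' →
      Tot p s' k fun s'' => Inv (i + 1) (s''.setVar x (i + 1))) :
    Tot (.forLt x e p) s (2 + n * (2 + k)) fun s' => Inv n s' := by
  have hframe : Frame (.forLt x e p) s (s.setVar x 0) := by
    refine (Run.assign s x (.const 0)).frame.mono ?_ ?_ ?_ <;>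
      simp +contextual [Prog.forLt, Prog.setsVar, Prog.setsArray, Prog.emits]
  have key := Tot.loop (p := .seq p (.assign x (.op .add (.var x) (.const 1))))
    (e := .op .sub e (.var x)) (s := s.setVar x 0) (k := k + 1)
    (Inv := fun m s' => ∃ i, i + m = n ∧ s'.vars x = i ∧ Inv i s') (n := n) ?_
    ⟨0, by simp, by simp [State.setVar], h₀⟩
  -- Each pass pays for the test, the body and the increment; the initial assignment and the last
  -- test account for the other two steps.
  · rw [show 2 + n * (2 + k) = 1 + (1 + n * (1 + (k + 1))) by ring]
    refine Tot.seq (Tot.assign ?_)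
    refine key.imp fun s' hf ⟨hz, m, i, him, hi, hinv⟩ => ?_
    have hs : Frame (.forLt x e p) s s' := by
      refine hframe.trans (hf.mono ?_ ?_ ?_) <;>
        simp +contextual [Prog.forLt, Prog.setsVar, Prog.setsArray, Prog.emits]
    simp only [Expr.val, Op.apply, he s' hs, hi] at hz
    have : i = n := by omega
    exact this ▸ hinv
  · rintro m s' hf hz ⟨i, him, hi, hinv⟩
    have hs : Frame (.forLt x e p) s s' := by
      refine hframe.trans (hf.mono ?_ ?_ ?_) <;>
        simp +contextual [Prog.forLt, Prog.setsVar, Prog.setsArray, Prog.emits]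
    simp only [Expr.val, Op.apply, he s' hs, hi] at hz
    refine ⟨by omega, Tot.seq ((hstep i (by omega) s' hs hi hinv).imp fun s'' hf' hq =>
      Tot.assign ?_)⟩
    have hx' : s''.vars x = i := (hf'.vars x hx).trans hi
    refine ⟨i + 1, by omega, ?_, ?_⟩
    · simp [State.setVar, Expr.val, Op.apply, hx']
    · simpa [Expr.val, Op.apply, hx'] using hq

end

end Ram

namespace Hungarian

/-! ### The Hungarian method

The columns are `0, …, N - 1`, and `N` is an additional virtual column. `mt j` is `0` if the column
`j` is free, and `i + 1` if it is matched to the row `i`. The potential of the row `i` is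
`u (i + 1)`, and `p j` is the price of the column `j`. -/

/-- The columns, except for the hole `h`, are matched to the first `r` rows by tight edges; the
dual solution is feasible, and free columns have price `0`. -/
structure Holed (M N : ℕ) (w : ℕ → ℕ → ℕ) (r h : ℕ) (mt u p : ℕ → ℕ) : Prop where
  le : ∀ j ≤ N, j ≠ h → mt j ≤ r
  inj : ∀ j ≤ N, ∀ j' ≤ N, j ≠ h → j' ≠ h → mt j ≠ 0 → mt j = mt j' → j = j'
  cov : ∀ i, 1 ≤ i → i ≤ r → ∃ j ≤ N, j ≠ h ∧ mt j = i
  feas : ∀ i < M, ∀ j < N, u (i + 1) ≤ w i j + p j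
  tight : ∀ j < N, j ≠ h → mt j ≠ 0 → u (mt j) = w (mt j - 1) j + p j
  free : ∀ j < N, j ≠ h → mt j = 0 → p j = 0

variable {M N r : ℕ} {w : ℕ → ℕ → ℕ} {mt u p : ℕ → ℕ}

/-- A hole at `N` means that the virtual column is empty, as it is between phases. A hole at `N + 1`
lies beyond all columns, so that there is no exception at all; this is the situation during a
search. -/
theorem Holed.init (u p : ℕ → ℕ) (hu : ∀ i, u i = 0) (hp : ∀ j, p j = 0) (hmt : ∀ j, mt j = 0) :
    Holed M N w 0 N mt u p where
  le j _ _ := by simp [hmt]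
  inj j _ j' _ _ _ h := by simp [hmt] at h
  cov i _ _ := by omega
  feas i _ j _ := by simp [hu]
  tight j _ _ h := by simp [hmt] at h
  free j _ _ _ := hp j

/-- A new row is put into the virtual column. -/
theorem Holed.addRow (h : Holed M N w r N mt u p) :
    Holed M N w (r + 1) (N + 1) (Function.update mt N (r + 1)) u p where
  le j hj _ := by
    by_cases hN : j = N
    · simp [hN]
    · have := h.le j hj hN
      simp [hN]; omega
  inj j hj j' hj' _ _ h₀ heq := by
    by_cases hN : j = N <;> by_cases hN' : j' = N
    · omega
    · have := h.le j' hj' hN'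
      simp [hN, hN'] at heq; omega
    · have := h.le j hj hN
      simp [hN, hN'] at heq; omega
    · simp only [Function.update_of_ne hN, Function.update_of_ne hN'] at h₀ heq
      exact h.inj j hj j' hj' hN hN' h₀ heq
  cov i hi hir := by
    by_cases hr : i = r + 1
    · exact ⟨N, le_rfl, by omega, by simp [hr]⟩
    · obtain ⟨j, hj, hjN, hm⟩ := h.cov i hi (by omega)
      exact ⟨j, hj, by omega, by simp [hjN, hm]⟩
  feas := h.feas
  tight j hj _ h₀ := by
    rw [Function.update_of_ne (by omega)] at h₀ ⊢
    exact h.tight j hj (by omega) h₀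
  free j hj _ h₀ := by
    rw [Function.update_of_ne (by omega)] at h₀
    exact h.free j hj (by omega) h₀

/-- The alternating tree rooted at the virtual column: the columns with `U` and the column `j₀`,
which was reached last. The tight edge to a column comes from the row matched to its predecessor
`way j`; the order in which the columns were reached is given by `ts`. -/
structure Tree (N : ℕ) (w : ℕ → ℕ → ℕ) (U : ℕ → Prop) (way mt u p : ℕ → ℕ) (j₀ : ℕ) (ts : ℕ → ℕ)
    (c : ℕ) : Prop where
  mem : ∀ j, U j → j ≤ N ∧ mt j ≠ 0
  root : U N ∨ j₀ = N
  le : j₀ ≤ N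
  not_mem : ¬ U j₀
  edge : ∀ j, U j ∨ j = j₀ → j ≠ N →
    U (way j) ∧ u (mt (way j)) = w (mt (way j) - 1) j + p j ∧ ts (way j) < ts j
  ts_le : ∀ j, U j ∨ j = j₀ → ts j ≤ c
  card : ∃ S : Finset ℕ, (∀ j, j ∈ S ↔ U j) ∧ S.card = c

variable {U : ℕ → Prop} {way ts : ℕ → ℕ} {j₀ c : ℕ}

theorem Tree.init (way mt u p : ℕ → ℕ) :
    Tree N w (fun _ => False) way mt u p N (fun _ => 0) 0 where
  mem _ h := h.elim
  root := .inr rfl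
  le := le_rfl
  not_mem := id
  edge j h hj := absurd (h.resolve_left id) hj
  ts_le _ _ := le_rfl
  card := ⟨∅, by simp, rfl⟩

/-- Of the `N + 1` columns at least `j₀` is not among the marked ones. This bounds both the number
of growth steps of a phase and the length of the augmenting path. -/
theorem Tree.card_le (h : Tree N w U way mt u p j₀ ts c) : c ≤ N := by
  obtain ⟨S, hS, rfl⟩ := h.card
  have : insert j₀ S ⊆ Finset.range (N + 1) := by
    intro j hj
    rw [Finset.mem_insert, hS] at hj
    rw [Finset.mem_range]
    rcases hj with rfl | hj
    · have := h.le; omega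
    · have := (h.mem j hj).1; omega
  have := Finset.card_le_card this
  rw [Finset.card_insert_of_notMem (by rw [hS]; exact h.not_mem), Finset.card_range] at this
  omega

/-- The tree does not contain all columns. -/
theorem Holed.exists_not_mem (h : Holed M N w r (N + 1) mt u p) (hr : r ≤ N)
    (hU : ∀ j, U j → j ≤ N ∧ mt j ≠ 0) (hN : U N) : ∃ j < N, ¬ U j := by
  by_contra! hcon
  have hall : ∀ j ∈ Finset.range (N + 1), U j := fun j hj => by
    rw [Finset.mem_range] at hj
    rcases Nat.lt_succ_iff_lt_or_eq.1 hj with hj | rfl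
    · exact hcon j hj
    · exact hN
  have hmaps : ∀ j ∈ Finset.range (N + 1), mt j ∈ Finset.Icc 1 r := fun j hj => by
    have hm := hU j (hall j hj)
    have := h.le j hm.1 (by omega)
    rw [Finset.mem_Icc]
    omega
  -- Pigeonhole: `N + 1` columns would be matched to at most `N` rows.
  obtain ⟨j, hj, j', hj', hne, heq⟩ :=
    Finset.exists_ne_map_eq_of_card_lt_of_maps_to (by simp; omega) hmaps
  have h₁ := hU j (hall j hj)
  have h₂ := hU j' (hall j' hj')
  exact hne (h.inj j h₁.1 j' h₂.1 (by omega) (by omega) h₁.2 heq)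

variable {u' p' : ℕ → ℕ} {δ : ℕ}

/-- The dual solution is changed by `δ` on the columns with `U` and the rows matched to them. -/
structure DualStep (N : ℕ) (U : ℕ → Prop) (mt u p : ℕ → ℕ) (δ : ℕ) (u' p' : ℕ → ℕ) : Prop where
  row_add : ∀ j, U j → u' (mt j) = u (mt j) + δ
  row_eq : ∀ i, (∀ j, U j → mt j ≠ i) → u' i = u i
  col_add : ∀ j, U j → p' j = p j + δ
  col_eq : ∀ j, ¬ U j → p' j = p j

/-- If row and column of an edge are both in the tree, the shifts cancel; if only the column is, the
slack grows; if only the row is, the slack drops by `δ`, which `hδ` allows. A matched row is in the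
tree exactly if its column is, so matching edges stay tight, and free columns are outside and keep
price `0`. -/
theorem Holed.dualStep (h : Holed M N w r (N + 1) mt u p)
    (hU : ∀ j, U j → j ≤ N ∧ mt j ≠ 0) (hd : DualStep N U mt u p δ u' p')
    (hδ : ∀ j, U j → ∀ j' < N, ¬ U j' → δ ≤ w (mt j - 1) j' + p j' - u (mt j)) :
    Holed M N w r (N + 1) mt u' p' where
  le := h.le
  inj := h.inj
  cov := h.cov
  feas i hi j hj := by
    have hf := h.feas i hi j hj
    by_cases hjU : U j
    · rw [hd.col_add j hjU]
      by_cases hiU : ∃ k, U k ∧ mt k = i + 1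
      · obtain ⟨k, hk, hki⟩ := hiU
        have := hd.row_add k hk
        rw [hki] at this
        omega
      · rw [hd.row_eq (i + 1) (fun k hk hki => hiU ⟨k, hk, hki⟩)]
        omega
    · rw [hd.col_eq j hjU]
      by_cases hiU : ∃ k, U k ∧ mt k = i + 1
      · obtain ⟨k, hk, hki⟩ := hiU
        have := hd.row_add k hk
        have hle := hδ k hk j hj hjU
        rw [hki] at this hle
        simp only [Nat.add_sub_cancel] at hle
        omega
      · rw [hd.row_eq (i + 1) (fun k hk hki => hiU ⟨k, hk, hki⟩)]
        omega
  tight j hj hjN h₀ := by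
    have ht := h.tight j hj hjN h₀
    by_cases hjU : U j
    · rw [hd.col_add j hjU, hd.row_add j hjU]
      omega
    · rw [hd.col_eq j hjU, hd.row_eq (mt j)]
      · exact ht
      · intro k hk hkj
        have := h.inj k (hU k hk).1 j hj.le (by have := (hU k hk).1; omega) hjN (hU k hk).2 hkj
        exact hjU (this ▸ hk)
  free j hj hjN h₀ := by
    have hjU : ¬ U j := fun hjU => (hU j hjU).2 h₀
    rw [hd.col_eq j hjU]
    exact h.free j hj hjN h₀

/-- The next column of the tree. -/
theorem Tree.extend {U' : ℕ → Prop} {j₁ jb : ℕ}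
    (hh : Holed M N w r (N + 1) mt u p) (hr : r ≤ M)
    (h : Tree N w U way mt u p j₀ ts c) (hj₀ : mt j₀ ≠ 0)
    (hU' : ∀ j, U' j ↔ U j ∨ j = j₀) (hd : DualStep N U' mt u p δ u' p')
    (hj₁ : j₁ < N) (hj₁U : ¬ U' j₁) (hjb : U' jb)
    (hδ : δ = w (mt jb - 1) j₁ + p j₁ - u (mt jb)) :
    Tree N w U' (Function.update way j₁ jb) mt u' p' j₁ (Function.update ts j₁ (c + 1))
      (c + 1) where
  mem j hj := by
    rcases (hU' j).1 hj with hj | rfl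
    · exact h.mem j hj
    · exact ⟨h.le, hj₀⟩
  root := .inl ((hU' N).2 (h.root.imp_right Eq.symm))
  le := hj₁.le
  not_mem := hj₁U
  edge j hj hjN := by
    by_cases hjj : j = j₁
    · subst hjj
      have hne : jb ≠ j := fun e => hj₁U (e ▸ hjb)
      have hmt : mt jb ≠ 0 ∧ jb ≤ N := by
        rcases (hU' jb).1 hjb with hb | rfl
        · exact (h.mem jb hb).symm
        · exact ⟨hj₀, h.le⟩
      rw [Function.update_self, Function.update_self, Function.update_of_ne hne,
        hd.row_add jb hjb, hd.col_eq j hj₁U]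
      have hle := hh.le jb hmt.2 (by omega)
      -- Dual feasibility makes the truncated difference `δ` exact, so the new edge becomes tight.
      -- Its time stamp `c + 1` exceeds all earlier ones.
      have hf := hh.feas (mt jb - 1) (by omega) j hj₁
      rw [Nat.sub_add_cancel (by omega)] at hf
      exact ⟨hjb, by omega, Nat.lt_succ_of_le (h.ts_le jb ((hU' jb).1 hjb))⟩
    · have hjU' := hj.resolve_right hjj
      obtain ⟨h₁, h₂, h₃⟩ := h.edge j ((hU' j).1 hjU') hjN
      have hw : U' (way j) := (hU' _).2 (.inl h₁)
      have hne : way j ≠ j₁ := fun e => hj₁U (e ▸ hw)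
      -- For an older edge of the tree, row potential and column price both rise by `δ`.
      rw [Function.update_of_ne hjj, Function.update_of_ne hne, Function.update_of_ne hjj,
        hd.row_add _ hw, hd.col_add j hjU']
      exact ⟨hw, by omega, h₃⟩
  ts_le j hj := by
    by_cases hjj : j = j₁
    · simp [hjj]
    · rw [Function.update_of_ne hjj]
      exact (h.ts_le j ((hU' j).1 (hj.resolve_right hjj))).trans (Nat.le_succ c)
  card := by
    obtain ⟨S, hS, hc⟩ := h.card
    refine ⟨insert j₀ S, fun j => ?_, ?_⟩
    · rw [Finset.mem_insert, hS, hU', or_comm]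
    · rw [Finset.card_insert_of_notMem (by rw [hS]; exact h.not_mem), hc]

/-- The matching `mt'` arises from the matching `mt` by moving the hole from the free column `j₀`
along the tree to the column `j`. -/
structure Aug (M N : ℕ) (w : ℕ → ℕ → ℕ) (r : ℕ) (U : ℕ → Prop) (mt u p : ℕ → ℕ) (j₀ : ℕ)
    (ts mt' : ℕ → ℕ) (j : ℕ) : Prop where
  holed : Holed M N w r j mt' u p
  mem : U j ∨ j = j₀
  agree : ∀ i, U i → ts i < ts j → mt' i = mt i

/-- A free column can be declared the hole, since no row is matched there. -/
theorem Aug.init (hh : Holed M N w r (N + 1) mt u p) (hj₀ : mt j₀ = 0) : Aug M N w r U mt u p j₀ ts mt j₀ where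
  holed :=
    { le := fun j hj _ => hh.le j hj (by omega)
      inj := fun j hj j' hj' _ _ => hh.inj j hj j' hj' (by omega) (by omega)
      cov := fun i hi hir => by
        obtain ⟨j, hj, _, hm⟩ := hh.cov i hi hir
        exact ⟨j, hj, fun e => by rw [e] at hm; omega, hm⟩
      feas := hh.feas
      tight := fun j hj _ => hh.tight j hj (by omega)
      free := fun j hj _ => hh.free j hj (by omega) }
  mem := .inr rfl
  agree _ _ _ := rfl

/-- The column `j` takes over the row of its predecessor, which becomes the hole. Time stamps
decrease along the path, so the predecessor has not been touched yet (`agree`) and still holds its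
original row, for which the tree edge to `j` is tight. -/
theorem Aug.step {mt' : ℕ → ℕ} {j : ℕ} (h : Tree N w U way mt u p j₀ ts c)
    (ha : Aug M N w r U mt u p j₀ ts mt' j) (hj : j ≠ N) :
    ts (way j) < ts j ∧
      Aug M N w r U mt u p j₀ ts (Function.update mt' j (mt' (way j))) (way j) := by
  obtain ⟨h₁, h₂, h₃⟩ := h.edge j ha.mem hj
  have hjle : j ≤ N := by
    rcases ha.mem with hm | rfl
    · exact (h.mem j hm).1
    · exact h.le
  have hne : way j ≠ j := fun e => by rw [e] at h₃; omega
  have hwle := (h.mem _ h₁).1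
  have hag := ha.agree _ h₁ h₃
  have hh := ha.holed
  refine ⟨h₃, ⟨?_, .inl h₁, fun i hi hlt => ?_⟩⟩
  · refine ⟨fun i hi hiw => ?_, fun i hi i' hi' hiw hiw' => ?_, fun i hi hir => ?_, hh.feas,
      fun i hi hiw => ?_, fun i hi hiw => ?_⟩
    · by_cases hij : i = j
      · rw [hij, Function.update_self]
        exact hh.le _ hwle hne
      · rw [Function.update_of_ne hij]
        exact hh.le i hi hij
    · by_cases hij : i = j <;> by_cases hij' : i' = j
      · intros; omega
      · rw [hij, Function.update_self, Function.update_of_ne hij']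
        intro h₀ heq
        exact absurd (hh.inj _ hwle i' hi' hne hij' h₀ heq).symm hiw'
      · rw [hij', Function.update_self, Function.update_of_ne hij]
        intro h₀ heq
        exact absurd (hh.inj i hi _ hwle hij hne h₀ heq) hiw
      · rw [Function.update_of_ne hij', Function.update_of_ne hij]
        exact hh.inj i hi i' hi' hij hij'
    · obtain ⟨k, hk, hkj, hm⟩ := hh.cov i hi hir
      by_cases hkw : k = way j
      · exact ⟨j, hjle, hne.symm, by rw [Function.update_self, ← hkw, hm]⟩
      · exact ⟨k, hk, hkw, by rw [Function.update_of_ne hkj, hm]⟩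
    · by_cases hij : i = j
      · rw [hij, Function.update_self]
        intro _
        rw [hag]
        exact h₂
      · rw [Function.update_of_ne hij]
        exact hh.tight i hi hij
    · by_cases hij : i = j
      · rw [hij, Function.update_self, hag]
        exact fun h₀ => absurd h₀ (h.mem _ h₁).2
      · rw [Function.update_of_ne hij]
        exact hh.free i hi hij
  · have hij : i ≠ j := fun e => by rw [e] at hlt; omega
    rw [Function.update_of_ne hij]
    exact ha.agree i hi (by omega)

/-- A matching of all rows by tight edges has minimum weight. -/
theorem Holed.isMin (h : Holed M N w M N mt u p) {σ τ : Fin M → Fin N}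
    (hσ : ∀ m, mt (σ m) = m + 1) (hτ : Function.Injective τ) :
    ∑ m : Fin M, w m (σ m) ≤ ∑ m : Fin M, w m (τ m) := by
  have hσinj : Function.Injective σ := fun m m' e => by
    have h₁ := hσ m
    rw [e, hσ m'] at h₁
    exact Fin.ext (by omega)
  have h₁ : ∑ m : Fin M, w m (σ m) + ∑ m : Fin M, p (σ m) = ∑ m : Fin M, u (m + 1) := by
    rw [← Finset.sum_add_distrib]
    refine Finset.sum_congr rfl fun m _ => ?_
    have := h.tight (σ m) (σ m).2 (σ m).2.ne (by rw [hσ]; omega)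
    rw [hσ, Nat.add_sub_cancel] at this
    exact this.symm
  have h₂ : ∑ m : Fin M, u (m + 1) ≤ ∑ m : Fin M, w m (τ m) + ∑ m : Fin M, p (τ m) := by
    rw [← Finset.sum_add_distrib]
    exact Finset.sum_le_sum fun m _ => h.feas m m.2 (τ m) (τ m).2
  have h₃ : ∑ m : Fin M, p (τ m) ≤ ∑ j : Fin N, p j := by
    rw [← Finset.sum_image (f := fun j : Fin N => p j) (g := τ) hτ.injOn]
    exact Finset.sum_le_sum_of_subset (Finset.subset_univ _)
  -- Complementary slackness: all rows are matched through `σ`, so a column outside its image is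
  -- free and has price `0`.
  have h₄ : ∑ j : Fin N, p j = ∑ m : Fin M, p (σ m) := by
    rw [← Finset.sum_image (f := fun j : Fin N => p j) (g := σ) hσinj.injOn]
    symm
    refine Finset.sum_subset (Finset.subset_univ _) fun j _ hj => ?_
    refine h.free j j.2 j.2.ne ?_
    by_contra h₀
    have hle := h.le j j.2.le j.2.ne
    refine hj (Finset.mem_image.2 ⟨⟨mt j - 1, by omega⟩, Finset.mem_univ _, ?_⟩)
    refine Fin.ext (h.inj _ (σ _).2.le _ j.2.le (σ _).2.ne j.2.ne ?_ ?_)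
    · rw [hσ]; omega
    · rw [hσ]; simp only; omega
  omega

end Hungarian

/-! ### Single-channel allocations and assignments -/

section

variable {M N : ℕ} {ℓ : Fin M → Fin N → ℝ} {R : Fin M → ℝ}

theorem singleChannel_userPower (σ : Fin M → Fin N) (m : Fin M) :
    (singleChannel ℓ R σ).userPower m = R m / ℓ m (σ m) := by
  simp [Allocation.userPower, singleChannel]

theorem singleChannel_totalPower (σ : Fin M → Fin N) :
    (singleChannel ℓ R σ).totalPower = ∑ m, R m / ℓ m (σ m) := by
  simp [Allocation.totalPower, singleChannel_userPower]

theorem singleChannel_isFeasible_iff (hR : ∀ m, 0 < R m) (hℓ : ∀ m n, 0 ≤ ℓ m n)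
    (σ : Fin M → Fin N) :
    (linearMPCA ℓ R).IsFeasible (singleChannel ℓ R σ) ↔
      Function.Injective σ ∧ ∀ m, 0 < ℓ m (σ m) := by
  constructor
  · rintro ⟨h₁, _, h₃⟩
    refine ⟨fun m m' e => ?_, fun m => ?_⟩
    · by_contra hne
      have := h₁ m m' hne
      simp [singleChannel, e] at this
    · by_contra hlt
      have h0 : ℓ m (σ m) = 0 := le_antisymm (not_lt.1 hlt) (hℓ _ _)
      have := h₃ m
      simp only [linearMPCA, singleChannel, Finset.sum_singleton, h0, zero_mul] at this
      exact absurd this (not_le.2 (hR m))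
  · rintro ⟨h₁, h₂⟩
    refine ⟨fun m m' hne => ?_, fun m n _ => div_nonneg (hR m).le (hℓ m n), fun m => ?_⟩
    · simpa [singleChannel] using fun e => hne (h₁ e)
    · simp only [linearMPCA, singleChannel, Finset.sum_singleton]
      rw [mul_div_cancel₀ _ (h₂ m).ne']

section

variable {a : Allocation M N}

theorem MPCA.IsFeasible.chan_nonempty (hR : ∀ m, 0 < R m) (ha : (linearMPCA ℓ R).IsFeasible a)
    (m : Fin M) : (a.chan m).Nonempty := by
  rw [Finset.nonempty_iff_ne_empty]
  intro he
  have := ha.target_le m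
  rw [he, Finset.sum_empty] at this
  exact absurd this (not_le.2 (hR m))

theorem MPCA.IsFeasible.exists_best (hR : ∀ m, 0 < R m) (ha : (linearMPCA ℓ R).IsFeasible a)
    (m : Fin M) : ∃ n ∈ a.chan m, ∀ n' ∈ a.chan m, ℓ m n' ≤ ℓ m n :=
  Finset.exists_max_image _ (ℓ m) (ha.chan_nonempty hR m)

/-- Powers are nonnegative, so replacing each slope by the largest one only increases the rate. -/
theorem MPCA.IsFeasible.target_le_mul (ha : (linearMPCA ℓ R).IsFeasible a) {m : Fin M} {n : Fin N}
    (hn : ∀ n' ∈ a.chan m, ℓ m n' ≤ ℓ m n) : R m ≤ ℓ m n * a.userPower m := by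
  refine (ha.target_le m).trans ?_
  rw [Allocation.userPower, Finset.mul_sum]
  exact Finset.sum_le_sum fun n' hn' =>
    mul_le_mul_of_nonneg_right (hn n' hn') (ha.power_nonneg m n' hn')

/-- The best slope is positive because the target is, so `target_le_mul` can be divided by it;
disjointness of the channel sets makes `σ` injective. -/
theorem MPCA.IsFeasible.singleChannel (hR : ∀ m, 0 < R m) (hℓ : ∀ m n, 0 ≤ ℓ m n)
    (ha : (linearMPCA ℓ R).IsFeasible a) {σ : Fin M → Fin N}
    (hσ : ∀ m, σ m ∈ a.chan m ∧ ∀ n ∈ a.chan m, ℓ m n ≤ ℓ m (σ m)) :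
    (linearMPCA ℓ R).IsFeasible (singleChannel ℓ R σ) ∧
      ∀ m, (_root_.singleChannel ℓ R σ).userPower m ≤ a.userPower m := by
  have hpos : ∀ m, 0 < ℓ m (σ m) := fun m => by
    refine (hℓ m (σ m)).lt_of_ne fun h0 => ?_
    have := ha.target_le_mul (hσ m).2
    rw [← h0, zero_mul] at this
    exact absurd this (not_le.2 (hR m))
  refine ⟨(singleChannel_isFeasible_iff hR hℓ σ).2 ⟨fun m m' e => ?_, hpos⟩, fun m => ?_⟩
  · by_contra hne
    exact Finset.disjoint_left.1 (ha.disjoint m m' hne) (hσ m).1 (e ▸ (hσ m').1)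
  · rw [singleChannel_userPower, div_le_iff₀' (hpos m)]
    exact ha.target_le_mul (hσ m).2

theorem MPCA.IsFeasible.exists_singleChannel (hR : ∀ m, 0 < R m) (hℓ : ∀ m n, 0 ≤ ℓ m n)
    (ha : (linearMPCA ℓ R).IsFeasible a) :
    ∃ σ : Fin M → Fin N, (linearMPCA ℓ R).IsFeasible (_root_.singleChannel ℓ R σ) ∧
      (_root_.singleChannel ℓ R σ).totalPower ≤ a.totalPower := by
  choose σ hσ using ha.exists_best hR
  obtain ⟨h₁, h₂⟩ := ha.singleChannel hR hℓ hσ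
  exact ⟨σ, h₁, Finset.sum_le_sum fun m _ => h₂ m⟩

end

/-- Optimality has to be checked among the single-channel allocations only. -/
theorem isOptimal_of_forall_singleChannel (hR : ∀ m, 0 < R m) (hℓ : ∀ m n, 0 ≤ ℓ m n)
    {a : Allocation M N} (ha : (linearMPCA ℓ R).IsFeasible a)
    (h : ∀ τ : Fin M → Fin N, Function.Injective τ → (∀ m, 0 < ℓ m (τ m)) →
      a.totalPower ≤ ∑ m, R m / ℓ m (τ m)) : (linearMPCA ℓ R).IsOptimal a := by
  refine ⟨ha, fun b hb => ?_⟩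
  obtain ⟨τ, hτ, hle⟩ := hb.exists_singleChannel hR hℓ
  have hτ' := (singleChannel_isFeasible_iff hR hℓ τ).1 hτ
  rw [singleChannel_totalPower] at hle
  exact (h τ hτ'.1 hτ'.2).trans hle

/-- There are finitely many `σ`, so the minimum is attained among them without any compactness
argument for the powers. -/
theorem exists_isOptimal_singleChannel (hR : ∀ m, 0 < R m) (hℓ : ∀ m n, 0 ≤ ℓ m n)
    (h : ∃ a, (linearMPCA ℓ R).IsFeasible a) :
    ∃ σ : Fin M → Fin N, (linearMPCA ℓ R).IsOptimal (singleChannel ℓ R σ) := by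
  classical
  obtain ⟨a, ha⟩ := h
  obtain ⟨σ₀, hσ₀, _⟩ := ha.exists_singleChannel hR hℓ
  obtain ⟨σ, hσ, hmin⟩ := Finset.exists_min_image
    (Finset.univ.filter fun σ : Fin M → Fin N => (linearMPCA ℓ R).IsFeasible (singleChannel ℓ R σ))
    (fun σ => (singleChannel ℓ R σ).totalPower) ⟨σ₀, by simpa using hσ₀⟩
  simp only [Finset.mem_filter, Finset.mem_univ, true_and] at hσ hmin
  refine ⟨σ, hσ, fun b hb => ?_⟩
  obtain ⟨τ, hτ, hle⟩ := hb.exists_singleChannel hR hℓ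
  exact (hmin τ hτ).trans hle

theorem matchingCost_assignmentCost (hMN : M ≤ N) (π : Equiv.Perm (Fin N)) :
    matchingCost (assignmentCost ℓ R) π =
      ∑ m, ENNReal.ofReal (R m) / ENNReal.ofReal (ℓ m (π (Fin.castLE hMN m))) := by
  rw [matchingCost, ← Finset.sum_subset (Finset.subset_univ
    (Finset.univ.map (Fin.castLEEmb hMN)))]
  · rw [Finset.sum_map]
    refine Finset.sum_congr rfl fun m _ => ?_
    simp [assignmentCost]
  · intro i _ hi
    have : ¬ i.val < M := fun h => hi (Finset.mem_map.2 ⟨⟨i, h⟩, Finset.mem_univ _, rfl⟩)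
    simp [assignmentCost, this]

theorem matchingCost_lt_top_iff (hMN : M ≤ N) (hR : ∀ m, 0 < R m) (π : Equiv.Perm (Fin N)) :
    matchingCost (assignmentCost ℓ R) π < ∞ ↔ ∀ m, 0 < ℓ m (π (Fin.castLE hMN m)) := by
  rw [matchingCost_assignmentCost hMN, ENNReal.sum_lt_top]
  refine forall_congr' fun m => ?_
  have : ENNReal.ofReal (R m) ≠ 0 := by simpa using hR m
  rw [lt_top_iff_ne_top, Ne, ENNReal.div_eq_top]
  simp [this, not_le]

theorem matchingCost_eq_ofReal (hMN : M ≤ N) (hR : ∀ m, 0 < R m) {π : Equiv.Perm (Fin N)}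
    (hπ : ∀ m, 0 < ℓ m (π (Fin.castLE hMN m))) :
    matchingCost (assignmentCost ℓ R) π =
      ENNReal.ofReal (singleChannel ℓ R fun m => π (Fin.castLE hMN m)).totalPower := by
  rw [matchingCost_assignmentCost hMN, singleChannel_totalPower,
    ENNReal.ofReal_sum_of_nonneg fun m _ => div_nonneg (hR m).le (hπ m).le]
  exact Finset.sum_congr rfl fun m _ => (ENNReal.ofReal_div_of_pos (hπ m)).symm

theorem singleChannel_perm_isFeasible_iff (hMN : M ≤ N) (hR : ∀ m, 0 < R m)
    (hℓ : ∀ m n, 0 ≤ ℓ m n) (π : Equiv.Perm (Fin N)) :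
    (linearMPCA ℓ R).IsFeasible (singleChannel ℓ R fun m => π (Fin.castLE hMN m)) ↔
      matchingCost (assignmentCost ℓ R) π < ∞ := by
  rw [matchingCost_lt_top_iff hMN hR, singleChannel_isFeasible_iff hR hℓ]
  exact and_iff_right (π.injective.comp (Fin.castLE_injective hMN))

/-- The artificial users receive the channels outside the range of `σ`, in any order: a bijection
between two subsets of a finite type extends to a permutation. -/
theorem exists_perm_extending (hMN : M ≤ N) {σ : Fin M → Fin N} (hσ : Function.Injective σ) :
    ∃ π : Equiv.Perm (Fin N), (fun m => π (Fin.castLE hMN m)) = σ := by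
  classical
  let e : {i : Fin N // i ∈ Set.range (Fin.castLE hMN)} ≃ {i : Fin N // i ∈ Set.range σ} :=
    (Equiv.ofInjective (Fin.castLE hMN) (Fin.castLE_injective hMN)).symm.trans
      (Equiv.ofInjective σ hσ)
  refine ⟨e.extendSubtype, funext fun m => ?_⟩
  rw [Equiv.extendSubtype_apply_of_mem e _ ⟨m, rfl⟩]
  have : (Equiv.ofInjective (Fin.castLE hMN) (Fin.castLE_injective hMN)).symm
      ⟨Fin.castLE hMN m, m, rfl⟩ = m := by
    rw [Equiv.symm_apply_eq]; rfl
  simp [e, this]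

theorem exists_isFeasible_iff (hMN : M ≤ N) (hR : ∀ m, 0 < R m) (hℓ : ∀ m n, 0 ≤ ℓ m n) :
    (∃ a, (linearMPCA ℓ R).IsFeasible a) ↔
      ∃ π : Equiv.Perm (Fin N), matchingCost (assignmentCost ℓ R) π < ∞ := by
  constructor
  · rintro ⟨a, ha⟩
    obtain ⟨σ, hσ, _⟩ := ha.exists_singleChannel hR hℓ
    obtain ⟨π, rfl⟩ := exists_perm_extending hMN ((singleChannel_isFeasible_iff hR hℓ σ).1 hσ).1
    exact ⟨π, (singleChannel_perm_isFeasible_iff hMN hR hℓ π).1 hσ⟩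
  · rintro ⟨π, hπ⟩
    exact ⟨_, (singleChannel_perm_isFeasible_iff hMN hR hℓ π).2 hπ⟩

/-- A permutation of finite cost is a feasible allocation of the same power, and one of infinite
cost does not lower the infimum; conversely an allocation is dominated by a single-channel one,
which extends to a permutation. -/
theorem ofReal_totalPower_eq (hMN : M ≤ N) (hR : ∀ m, 0 < R m) (hℓ : ∀ m n, 0 ≤ ℓ m n)
    {a : Allocation M N} (ha : (linearMPCA ℓ R).IsOptimal a) :
    ENNReal.ofReal a.totalPower =
      ⨅ π : Equiv.Perm (Fin N), matchingCost (assignmentCost ℓ R) π := by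
  refine le_antisymm (le_iInf fun π => ?_) ?_
  · by_cases hπ : matchingCost (assignmentCost ℓ R) π < ∞
    · rw [matchingCost_eq_ofReal hMN hR ((matchingCost_lt_top_iff hMN hR π).1 hπ)]
      exact ENNReal.ofReal_le_ofReal
        (ha.2 _ ((singleChannel_perm_isFeasible_iff hMN hR hℓ π).2 hπ))
    · rw [not_lt_top_iff.1 hπ]
      exact le_top
  · obtain ⟨σ, hσ, hle⟩ := ha.1.exists_singleChannel hR hℓ
    obtain ⟨π, rfl⟩ := exists_perm_extending hMN ((singleChannel_isFeasible_iff hR hℓ σ).1 hσ).1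
    have hπ := (singleChannel_perm_isFeasible_iff hMN hR hℓ π).1 hσ
    refine (iInf_le _ π).trans ?_
    rw [matchingCost_eq_ofReal hMN hR ((matchingCost_lt_top_iff hMN hR π).1 hπ)]
    exact ENNReal.ofReal_le_ofReal hle

theorem isOptimal_iff_isMinCostAssignment (hMN : M ≤ N) (hR : ∀ m, 0 < R m)
    (hℓ : ∀ m n, 0 ≤ ℓ m n) (π : Equiv.Perm (Fin N)) :
    (linearMPCA ℓ R).IsOptimal (singleChannel ℓ R fun m => π (Fin.castLE hMN m)) ↔
      IsMinCostAssignment (assignmentCost ℓ R) π := by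
  constructor
  · intro h
    have hπ := (singleChannel_perm_isFeasible_iff hMN hR hℓ π).1 h.1
    refine ⟨hπ, fun π' => ?_⟩
    rw [matchingCost_eq_ofReal hMN hR ((matchingCost_lt_top_iff hMN hR π).1 hπ),
      ofReal_totalPower_eq hMN hR hℓ h]
    exact iInf_le _ π'
  · rintro ⟨hπ, hmin⟩
    have hf := (singleChannel_perm_isFeasible_iff hMN hR hℓ π).2 hπ
    obtain ⟨σ, hσ⟩ := exists_isOptimal_singleChannel hR hℓ ⟨_, hf⟩
    refine ⟨hf, fun b hb => le_trans ?_ (hσ.2 b hb)⟩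
    have hpos : ∀ m, 0 < ℓ m (σ m) := ((singleChannel_isFeasible_iff hR hℓ σ).1 hσ.1).2
    -- Comparing real powers through `ENNReal.ofReal` requires the right-hand side to be
    -- nonnegative, which is the second goal.
    rw [← ENNReal.ofReal_le_ofReal_iff, ofReal_totalPower_eq hMN hR hℓ hσ,
      ← matchingCost_eq_ofReal hMN hR ((matchingCost_lt_top_iff hMN hR π).1 hπ)]
    · exact le_iInf hmin
    · rw [singleChannel_totalPower]
      exact Finset.sum_nonneg fun m _ => div_nonneg (hR m).le (hpos m).le

end

/-! ### Notation for expressions, and evaluation rules. -/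

namespace Ram

instance : Add Expr := ⟨.op .add⟩
instance : Sub Expr := ⟨.op .sub⟩
instance : Mul Expr := ⟨.op .mul⟩
instance : Div Expr := ⟨.op .div⟩
instance (n : ℕ) [n.AtLeastTwo] : OfNat Expr n := ⟨.const n⟩
instance : Zero Expr := ⟨.const 0⟩
instance : One Expr := ⟨.const 1⟩

@[simp] theorem Expr.val_add (s : State) (e₁ e₂ : Expr) : (e₁ + e₂).val s = e₁.val s + e₂.val s := rfl
@[simp] theorem Expr.val_sub (s : State) (e₁ e₂ : Expr) : (e₁ - e₂).val s = e₁.val s - e₂.val s := rfl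
@[simp] theorem Expr.val_mul (s : State) (e₁ e₂ : Expr) : (e₁ * e₂).val s = e₁.val s * e₂.val s := rfl
@[simp] theorem Expr.val_div (s : State) (e₁ e₂ : Expr) : (e₁ / e₂).val s = e₁.val s / e₂.val s := rfl
@[simp] theorem Expr.val_ofNat (s : State) (n : ℕ) [n.AtLeastTwo] :
    (ofNat(n) : Expr).val s = n := rfl
@[simp] theorem Expr.val_zero (s : State) : (0 : Expr).val s = 0 := rfl
@[simp] theorem Expr.val_one (s : State) : (1 : Expr).val s = 1 := rfl

-- These are the defining equations for variables and array cells.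
attribute [simp] Expr.val.eq_2 Expr.val.eq_3

@[simp] theorem State.vars_setVar (s : State) (x v y : ℕ) :
    (s.setVar x v).vars y = if y = x then v else s.vars y := by
  simp [State.setVar, Function.update_apply]
@[simp] theorem State.arrays_setVar (s : State) (x v : ℕ) : (s.setVar x v).arrays = s.arrays := rfl
@[simp] theorem State.output_setVar (s : State) (x v : ℕ) : (s.setVar x v).output = s.output := rfl
@[simp] theorem State.vars_setCell (s : State) (A i v : ℕ) : (s.setCell A i v).vars = s.vars := rfl
@[simp] theorem State.arrays_setCell (s : State) (A i v B : ℕ) :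
    (s.setCell A i v).arrays B =
      if B = A then Function.update (s.arrays A) i v else s.arrays B := by
  simp [State.setCell, Function.update_apply]
@[simp] theorem State.vars_emit (s : State) (v : ℕ) : (s.emit v).vars = s.vars := rfl
@[simp] theorem State.arrays_emit (s : State) (v : ℕ) : (s.emit v).arrays = s.arrays := rfl
@[simp] theorem State.output_emit (s : State) (v : ℕ) : (s.emit v).output = s.output ++ [v] := rfl

end Ram

namespace Solver

open Ram Hungarian

/-! ### The program

The variables are: `0` the length of the input, `1` the number `M` of users, `2` the number `N` of
channels, `3` a common denominator `D` of the costs, `4` a cost `B` for missing edges, `5`, `8`,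
`12` loop counters, `6` the current row, `7` the column that was reached last, `9`, `10`, `11` the
data of a candidate edge of minimum slack, `13` whether a missing edge is used. The arrays are: `0`
the input, `1` the matching, `2` and `3` the potentials of rows and columns, `4` marks for reached
columns, `5` predecessors. -/

/-- Numerator of the slope with index `q = m * N + n`. -/
def slopeNum (q : Expr) : Expr := .get 0 (2 + 2 * q)

/-- Denominator of the slope with index `q = m * N + n`. -/
def slopeDen (q : Expr) : Expr := .get 0 (3 + 2 * q)

/-- Numerator of the rate target of user `i`. -/
def targetNum (i : Expr) : Expr := .get 0 (2 + 2 * (.var 1 * .var 2) + 2 * i)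

/-- Denominator of the rate target of user `i`. -/
def targetDen (i : Expr) : Expr := .get 0 (3 + 2 * (.var 1 * .var 2) + 2 * i)

/-- The integral weight of a pair of a user and a channel. -/
def weightExpr (i j : Expr) : Expr :=
  .var 3 / targetDen i / slopeNum (i * .var 2 + j) * targetNum i * slopeDen (i * .var 2 + j) +
    (.var 4 - .var 4 * slopeNum (i * .var 2 + j))

/-- A single counter `q = b * N + j` runs over pairs. There is no remainder operation; the product
that replaces it stands in a subtrahend, where mildness does not restrict it. -/
def rowOf (q : Expr) : Expr := q / .var 2

def colOf (q : Expr) : Expr := q - .var 2 * (q / .var 2)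

/-- Nonzero if the column is reached in the current phase. -/
def reached (j : Expr) : Expr := .get 4 j - .var 6

/-- The slack of the edge between the row matched to the column `b` and the column `j`. -/
def slackExpr (b j : Expr) : Expr :=
  weightExpr (.get 1 b - 1) j + .get 3 j - .get 2 (.get 1 b)

/-- Computes `D` and `B`. -/
def prepare : Prog :=
  .seq (.assign 1 (.get 0 0)) <| .seq (.assign 2 (.get 0 1)) <| .seq (.assign 3 1) <|
  .seq (.assign 4 2) <| .forLt 5 (.var 0) <|
    .ite (.get 0 (.var 5))
      (.seq (.assign 3 (.var 3 * .get 0 (.var 5)))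
        (.assign 4 (.var 4 * .get 0 (.var 5) * .get 0 (.var 5) * .get 0 (.var 5))))
      .skip

/-- Finds an edge of minimum slack from a reached column to another column. -/
def findMin : Prog :=
  .seq (.assign 9 0) <| .forLt 8 (.var 2 * (.var 2 + 1)) <|
    -- Products act as conjunctions and sums as disjunctions: the first column is reached, the
    -- second is not, and either there is no candidate yet or the present one has larger slack.
    .ite (reached (rowOf (.var 8)) * (1 - reached (colOf (.var 8))) *
        ((1 - .var 9) + (.var 10 - slackExpr (rowOf (.var 8)) (colOf (.var 8)))))
      (.seq (.assign 9 1) <|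
        .seq (.assign 10 (slackExpr (rowOf (.var 8)) (colOf (.var 8)))) (.assign 11 (.var 8)))
      .skip

/-- Changes the potentials. -/
def update : Prog :=
  .forLt 12 (.var 2 + 1) <|
    .ite (reached (.var 12))
      (.seq (.store 2 (.get 1 (.var 12)) (.get 2 (.get 1 (.var 12)) + .var 10))
        (.store 3 (.var 12) (.get 3 (.var 12) + .var 10)))
      .skip

/-- Reaches one more column. -/
def grow : Prog :=
  .seq (.store 4 (.var 7) (.var 6 + 1)) <| .seq findMin <| .seq update <|
    .seq (.store 5 (colOf (.var 11)) (rowOf (.var 11))) (.assign 7 (colOf (.var 11)))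

/-- Augments the matching. -/
def augment : Prog :=
  .loop (.var 2 - .var 7) <|
    .seq (.store 1 (.var 7) (.get 1 (.get 5 (.var 7)))) (.assign 7 (.get 5 (.var 7)))

/-- Matches one more row. -/
def phase : Prog :=
  .seq (.store 1 (.var 2) (.var 6 + 1)) <| .seq (.assign 7 (.var 2)) <|
    .seq (.loop (.get 1 (.var 7)) grow) augment

/-- `1` if channel `q % N` is matched to user `q / N`, otherwise `0`. -/
def matchedExpr (q : Expr) : Expr :=
  1 - ((.get 1 (colOf q) - (rowOf q + 1)) + ((rowOf q + 1) - .get 1 (colOf q)))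

/-- Checks if a missing edge is used. -/
def checkMissing : Prog :=
  .seq (.assign 13 0) <| .forLt 8 (.var 1 * .var 2) <|
    .ite (matchedExpr (.var 8) * (1 - slopeNum (.var 8))) (.assign 13 1) .skip

/-- Emits the allocation. -/
def emitAll : Prog :=
  .seq (.emit 1) <| .forLt 8 (.var 1 * .var 2) <|
    .seq (.emit (matchedExpr (.var 8))) <|
    .seq (.emit (targetNum (rowOf (.var 8)) * slopeDen (.var 8)))
      -- The last summand keeps the denominator positive for unmatched pairs of slope `0`; for
      -- matched pairs it vanishes.
      (.emit (targetDen (rowOf (.var 8)) * slopeNum (.var 8) + (1 - matchedExpr (.var 8))))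

/-- The whole program. -/
def solve : Prog :=
  .seq prepare <| .seq (.forLt 6 (.var 1) phase) <| .seq checkMissing <|
    .ite (.var 13) (.emit 0) emitAll

theorem solve_mild : solve.mild = true := by decide

/-! ### Its correctness -/

/-- The integral weights, as a function of the input. -/
def weight (inp : ℕ → ℕ) (M N D B i j : ℕ) : ℕ :=
  D / inp (3 + 2 * (M * N) + 2 * i) / inp (2 + 2 * (i * N + j)) * inp (2 + 2 * (M * N) + 2 * i) *
    inp (3 + 2 * (i * N + j)) + (B - B * inp (2 + 2 * (i * N + j)))

/-- The values that do not change after the preparations. -/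
structure Ctx (inp : ℕ → ℕ) (M N D B : ℕ) (s : State) : Prop where
  v1 : s.vars 1 = M
  v2 : s.vars 2 = N
  v3 : s.vars 3 = D
  v4 : s.vars 4 = B
  a0 : s.arrays 0 = inp

variable {inp : ℕ → ℕ} {M N D B r : ℕ} {s s' : State}

theorem Ctx.frame {p : Prog} (h : Ctx inp M N D B s) (hf : Frame p s s')
    (hp : (p.setsVar 1 || p.setsVar 2 || p.setsVar 3 || p.setsVar 4 || p.setsArray 0) = false) :
    Ctx inp M N D B s' := by
  simp only [Bool.or_eq_false_iff] at hp
  obtain ⟨⟨⟨⟨h₁, h₂⟩, h₃⟩, h₄⟩, h₀⟩ := hp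
  exact ⟨(hf.vars 1 h₁).trans h.v1, (hf.vars 2 h₂).trans h.v2, (hf.vars 3 h₃).trans h.v3,
    (hf.vars 4 h₄).trans h.v4, (hf.arrays 0 h₀).trans h.a0⟩

theorem Ctx.weightExpr_val (h : Ctx inp M N D B s) (i j : Expr) :
    (weightExpr i j).val s = weight inp M N D B (i.val s) (j.val s) := by
  simp [weightExpr, weight, slopeNum, slopeDen, targetNum, targetDen, h.v1, h.v2, h.v3, h.v4, h.a0]

theorem Ctx.colOf_val (h : Ctx inp M N D B s) (q : Expr) : (colOf q).val s = q.val s % N := by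
  simp [colOf, h.v2, Nat.mod_def]

theorem Ctx.rowOf_val (h : Ctx inp M N D B s) (q : Expr) : (rowOf q).val s = q.val s / N := by
  simp [rowOf, h.v2]

theorem Ctx.slackExpr_val (h : Ctx inp M N D B s) (b j : Expr) :
    (slackExpr b j).val s =
      weight inp M N D B (s.arrays 1 (b.val s) - 1) (j.val s) + s.arrays 3 (j.val s) -
        s.arrays 2 (s.arrays 1 (b.val s)) := by
  simp [slackExpr, h.weightExpr_val]

/-- The edge with index `q` leads from a reached column to another one. -/
def Cand (N r : ℕ) (used : ℕ → ℕ) (q : ℕ) : Prop := r < used (q / N) ∧ ¬ r < used (q % N)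

/-- The slack of the edge with index `q`. -/
def slack (w : ℕ → ℕ → ℕ) (N : ℕ) (mt u p : ℕ → ℕ) (q : ℕ) : ℕ :=
  w (mt (q / N) - 1) (q % N) + p (q % N) - u (mt (q / N))

/-- The edge found among those with index less than `n`. -/
def FindMinInv (w : ℕ → ℕ → ℕ) (N r : ℕ) (mt u p used : ℕ → ℕ) (n : ℕ) (s : State) : Prop :=
  (s.vars 9 = 0 ∧ ∀ q < n, ¬ Cand N r used q) ∨
    (s.vars 9 = 1 ∧ s.vars 11 < n ∧ Cand N r used (s.vars 11) ∧
      s.vars 10 = slack w N mt u p (s.vars 11) ∧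
      ∀ q < n, Cand N r used q → s.vars 10 ≤ slack w N mt u p q)

theorem findMin_tot (h : Ctx inp M N D B s) (hr : s.vars 6 = r) :
    Tot findMin s (3 + N * (N + 1) * 6) (FindMinInv (weight inp M N D B) N r (s.arrays 1)
      (s.arrays 2) (s.arrays 3) (s.arrays 4) (N * (N + 1))) := by
  have key := Tot.forLt (x := 8) (e := .var 2 * (.var 2 + 1)) (s := s.setVar 9 0) (k := 4)
    (p := .ite (reached (rowOf (.var 8)) * (1 - reached (colOf (.var 8))) *
        ((1 - .var 9) + (.var 10 - slackExpr (rowOf (.var 8)) (colOf (.var 8)))))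
      (.seq (.assign 9 1) <|
        .seq (.assign 10 (slackExpr (rowOf (.var 8)) (colOf (.var 8)))) (.assign 11 (.var 8)))
      .skip)
    (Inv := FindMinInv (weight inp M N D B) N r (s.arrays 1)
      (s.arrays 2) (s.arrays 3) (s.arrays 4)) (n := N * (N + 1)) (by decide) ?_ ?_ ?_
  · refine Tot.mono (Tot.seq (Tot.assign key)) ?_
    omega
  · intro s' hf
    have := hf.vars 2 (by decide)
    simp at this
    simp [this, h.v2]
  · left; simp
  · intro i hi s' hf h8 hinv
    have h' : Ctx inp M N D B s' :=
      Ctx.frame (s := s.setVar 9 0) ⟨h.v1, h.v2, h.v3, h.v4, h.a0⟩ hf (by decide)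
    have h6 : s'.vars 6 = r := (hf.vars 6 (by decide)).trans hr
    have a1 : s'.arrays 1 = s.arrays 1 := hf.arrays 1 (by decide)
    have a2 : s'.arrays 2 = s.arrays 2 := hf.arrays 2 (by decide)
    have a3 : s'.arrays 3 = s.arrays 3 := hf.arrays 3 (by decide)
    have a4 : s'.arrays 4 = s.arrays 4 := hf.arrays 4 (by decide)
    have hsl : ∀ s'' : State, Ctx inp M N D B s'' → s''.vars 8 = i → s''.arrays = s'.arrays →
        (slackExpr (rowOf (.var 8)) (colOf (.var 8))).val s'' =
        slack (weight inp M N D B) N (s.arrays 1) (s.arrays 2) (s.arrays 3) i := by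
      intro s'' hc hv ha
      simp [hc.slackExpr_val, hc.rowOf_val, hc.colOf_val, hv, ha, a1, a2, a3, slack]
    have hval := hsl s' h' h8 rfl
    refine Tot.ite (fun hc => ?_) (fun hc => ?_)
    · have h'' : Ctx inp M N D B (s'.setVar 9 1) := ⟨h'.v1, h'.v2, h'.v3, h'.v4, h'.a0⟩
      have hval' := hsl (s'.setVar 9 1) h'' (by simpa using h8) rfl
      simp only [reached, Expr.val_mul, Expr.val_sub, Expr.val_add, Expr.val_one, h'.rowOf_val,
        h'.colOf_val, hval, Expr.val.eq_2, Expr.val.eq_3, h8, h6, a4, mul_ne_zero_iff] at hc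
      refine Tot.mono (Tot.seq (Tot.assign (Tot.seq (Tot.assign (Tot.assign ?_))))) (by omega)
      have hcand : Cand N r (s.arrays 4) i := ⟨by omega, by omega⟩
      refine .inr ⟨by simp, by simp [h8], by simpa [h8] using hcand,
        by simp [h8, hval'], fun q hq hqc => ?_⟩
      simp only [State.vars_setVar]
      norm_num [hval']
      rcases Nat.lt_succ_iff_lt_or_eq.1 hq with hq | rfl
      · rcases hinv with ⟨h9, hno⟩ | ⟨h9, _, _, _, hmin⟩
        · exact absurd hqc (hno q hq)
        · have := hmin q hq hqc
          omega
      · exact le_rfl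
    · simp only [reached, Expr.val_mul, Expr.val_sub, Expr.val_add, Expr.val_one, h'.rowOf_val,
        h'.colOf_val, hval, Expr.val.eq_2, Expr.val.eq_3, h8, h6, a4, mul_eq_zero] at hc
      refine Tot.mono (Tot.skip ?_) (by omega : 1 ≤ 3)
      rcases hinv with ⟨h9, hno⟩ | ⟨h9, hlt, hcd, h10, hmin⟩
      · refine .inl ⟨by simpa using h9, fun q hq => ?_⟩
        rcases Nat.lt_succ_iff_lt_or_eq.1 hq with hq | rfl
        · exact hno q hq
        · rintro ⟨hc₁, hc₂⟩
          omega
      · refine .inr ⟨by simpa using h9, by simp; omega, by simpa using hcd, by simpa using h10,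
          fun q hq hqc => ?_⟩
        simp only [State.vars_setVar]
        norm_num
        rcases Nat.lt_succ_iff_lt_or_eq.1 hq with hq | rfl
        · exact hmin q hq hqc
        · obtain ⟨hc₁, hc₂⟩ := hqc
          omega

/-- The shift is carried out column by column; as `mt` separates the marked columns, no row receives
`δ` twice. -/
theorem DualStep.insert {U : ℕ → Prop} {mt u p u' p' : ℕ → ℕ} {δ i : ℕ}
    (h : DualStep N (fun j => U j ∧ j < i) mt u p δ u' p') (hi : U i)
    (hinj : ∀ j, U j → j < i → mt j ≠ mt i) :
    DualStep N (fun j => U j ∧ j < i + 1) mt u p δ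
      (Function.update u' (mt i) (u' (mt i) + δ)) (Function.update p' i (p' i + δ)) where
  row_add j hj := by
    rcases Nat.lt_succ_iff_lt_or_eq.1 hj.2 with hlt | rfl
    · rw [Function.update_of_ne (hinj j hj.1 hlt), h.row_add j ⟨hj.1, hlt⟩]
    · rw [Function.update_self, h.row_eq (mt j) fun k hk => hinj k hk.1 hk.2]
  row_eq v hv := by
    rw [Function.update_of_ne (hv i ⟨hi, Nat.lt_succ_self i⟩).symm]
    exact h.row_eq v fun j hj => hv j ⟨hj.1, hj.2.trans (Nat.lt_succ_self i)⟩
  col_add j hj := by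
    rcases Nat.lt_succ_iff_lt_or_eq.1 hj.2 with hlt | rfl
    · rw [Function.update_of_ne hlt.ne, h.col_add j ⟨hj.1, hlt⟩]
    · rw [Function.update_self, h.col_eq j fun hj' => lt_irrefl _ hj'.2]
  col_eq j hj := by
    have hne : j ≠ i := fun e => hj ⟨e ▸ hi, e ▸ Nat.lt_succ_self i⟩
    rw [Function.update_of_ne hne]
    exact h.col_eq j fun hj' => hj ⟨hj'.1, hj'.2.trans (Nat.lt_succ_self i)⟩

theorem update_tot (h : Ctx inp M N D B s) (hr : s.vars 6 = r)
    (hU : ∀ j, r < s.arrays 4 j → j ≤ N)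
    (hinj : ∀ j j', r < s.arrays 4 j → r < s.arrays 4 j' → s.arrays 1 j = s.arrays 1 j' → j = j') :
    Tot update s (2 + (N + 1) * 5) fun s' =>
      DualStep N (fun j => r < s.arrays 4 j) (s.arrays 1) (s.arrays 2) (s.arrays 3) (s.vars 10)
        (s'.arrays 2) (s'.arrays 3) := by
  have key := Tot.forLt (x := 12) (e := .var 2 + 1) (s := s) (k := 3)
    (p := .ite (reached (.var 12))
      (.seq (.store 2 (.get 1 (.var 12)) (.get 2 (.get 1 (.var 12)) + .var 10))
        (.store 3 (.var 12) (.get 3 (.var 12) + .var 10)))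
      .skip)
    (Inv := fun i s' => DualStep N (fun j => r < s.arrays 4 j ∧ j < i) (s.arrays 1) (s.arrays 2)
      (s.arrays 3) (s.vars 10) (s'.arrays 2) (s'.arrays 3)) (n := N + 1) (by decide) ?_ ?_ ?_
  · refine key.imp fun s' _ hq => ?_
    have : (fun j => r < s.arrays 4 j ∧ j < N + 1) = fun j => r < s.arrays 4 j :=
      funext fun j => propext ⟨fun hj => hj.1, fun hj => ⟨hj, Nat.lt_succ_of_le (hU j hj)⟩⟩
    exact this ▸ hq
  · intro s' hf
    have := hf.vars 2 (by decide)
    simp [this, h.v2]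
  · exact ⟨fun j hj => absurd hj.2 (Nat.not_lt_zero j), fun _ _ => rfl,
      fun j hj => absurd hj.2 (Nat.not_lt_zero j), fun _ _ => rfl⟩
  · intro i hi s' hf h12 hinv
    have h6 : s'.vars 6 = r := (hf.vars 6 (by decide)).trans hr
    have h10 : s'.vars 10 = s.vars 10 := hf.vars 10 (by decide)
    have a1 : s'.arrays 1 = s.arrays 1 := hf.arrays 1 (by decide)
    have a4 : s'.arrays 4 = s.arrays 4 := hf.arrays 4 (by decide)
    refine Tot.ite (fun hc => ?_) (fun hc => ?_)
    · simp only [reached, Expr.val_sub, Expr.val.eq_2, Expr.val.eq_3, h12, h6, a4] at hc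
      refine Tot.mono (Tot.seq (Tot.store (Tot.store ?_))) (by omega)
      have hiU : r < s.arrays 4 i := by omega
      have := DualStep.insert (U := fun j => r < s.arrays 4 j) hinv hiU
        fun j hj hlt e => hlt.ne (hinj j i hj hiU e)
      simpa [h12, h10, a1] using this
    · simp only [reached, Expr.val_sub, Expr.val.eq_2, Expr.val.eq_3, h12, h6, a4] at hc
      refine Tot.mono (Tot.skip ?_) (by omega : 1 ≤ 2)
      have : (fun j => r < s.arrays 4 j ∧ j < i + 1) = fun j => r < s.arrays 4 j ∧ j < i := by
        funext j
        refine propext ⟨fun hj => ⟨hj.1, ?_⟩, fun hj => ⟨hj.1, by omega⟩⟩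
        rcases Nat.lt_succ_iff_lt_or_eq.1 hj.2 with hlt | rfl
        · exact hlt
        · have := hj.1; omega
      simp only [State.arrays_setVar, this]
      exact hinv

end Solver

/-! ### The phases: growing the tree and augmenting. -/

namespace Solver

open Ram Hungarian

variable {inp : ℕ → ℕ} {M N D B r : ℕ} {s s' : State}

/-- The state of the search for an augmenting path after `c` columns have been reached. -/
structure Search (inp : ℕ → ℕ) (M N D B r c : ℕ) (ts : ℕ → ℕ) (s : State) : Prop where
  ctx : Ctx inp M N D B s
  row : s.vars 6 = r
  mark_le : ∀ j, s.arrays 4 j ≤ r + 1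
  holed : Holed M N (weight inp M N D B) (r + 1) (N + 1) (s.arrays 1) (s.arrays 2) (s.arrays 3)
  tree : Tree N (weight inp M N D B) (fun j => r < s.arrays 4 j) (s.arrays 5) (s.arrays 1)
    (s.arrays 2) (s.arrays 3) (s.vars 7) ts c

/-- A bound for the number of steps of `grow`. -/
def growTime (N : ℕ) : ℕ := 8 + N * (N + 1) * 6 + (N + 1) * 5

/-- The minimum slack found is at once an admissible `δ` for `Holed.dualStep` and the one that makes
the chosen edge tight, as `Tree.extend` needs. -/
theorem grow_tot {c : ℕ} {ts : ℕ → ℕ} (hrM : r < M) (hMN : M ≤ N)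
    (h : Search inp M N D B r c ts s) (hmt : s.arrays 1 (s.vars 7) ≠ 0) :
    Tot grow s (growTime N) fun s' => ∃ ts', Search inp M N D B r (c + 1) ts' s' := by
  set j₀ := s.vars 7 with hj₀
  set mt := s.arrays 1
  have hU' : ∀ j, r < Function.update (s.arrays 4) j₀ (r + 1) j ↔ r < s.arrays 4 j ∨ j = j₀ := by
    intro j
    by_cases hj : j = j₀
    · simp [hj]
    · simp [hj]
  have hUmem : ∀ j, r < Function.update (s.arrays 4) j₀ (r + 1) j → j ≤ N ∧ mt j ≠ 0 := by
    intro j hj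
    rcases (hU' j).1 hj with hj | rfl
    · exact h.tree.mem j hj
    · exact ⟨h.tree.le, hmt⟩
  refine Tot.mono (k := 1 + (3 + N * (N + 1) * 6 + (2 + (N + 1) * 5 + (1 + 1)))) ?_
    (by unfold growTime; omega)
  refine Tot.seq (Tot.store ?_)
  set s₁ := s.setCell 4 ((Expr.var 7).val s) ((Expr.var 6 + 1).val s) with hs₁
  have hc₁ : Ctx inp M N D B s₁ := ⟨h.ctx.v1, h.ctx.v2, h.ctx.v3, h.ctx.v4, h.ctx.a0⟩
  have hu₁ : s₁.arrays 4 = Function.update (s.arrays 4) j₀ (r + 1) := by simp [hs₁, h.row, hj₀]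
  refine Tot.seq ((findMin_tot hc₁ h.row).imp fun s₂ hf₂ hmin => ?_)
  have hc₂ := hc₁.frame hf₂ (by decide)
  have hr₂ : s₂.vars 6 = r := (hf₂.vars 6 (by decide)).trans h.row
  have a1₂ : s₂.arrays 1 = mt := hf₂.arrays 1 (by decide)
  have a2₂ : s₂.arrays 2 = s.arrays 2 := hf₂.arrays 2 (by decide)
  have a3₂ : s₂.arrays 3 = s.arrays 3 := hf₂.arrays 3 (by decide)
  have a4₂ : s₂.arrays 4 = Function.update (s.arrays 4) j₀ (r + 1) :=
    (hf₂.arrays 4 (by decide)).trans hu₁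
  have a5₂ : s₂.arrays 5 = s.arrays 5 := hf₂.arrays 5 (by decide)
  have a1₁ : s₁.arrays 1 = mt := rfl
  have a2₁ : s₁.arrays 2 = s.arrays 2 := rfl
  have a3₁ : s₁.arrays 3 = s.arrays 3 := rfl
  rw [hu₁, a1₁, a2₁, a3₁] at hmin
  have hNpos : 0 < N := by omega
  have hidx : ∀ b ≤ N, ∀ j < N, b * N + j < N * (N + 1) ∧ (b * N + j) / N = b ∧
      (b * N + j) % N = j := fun b hb j hj => by
    refine ⟨by nlinarith, ?_, ?_⟩
    · rw [mul_comm, Nat.mul_add_div hNpos, Nat.div_eq_of_lt hj, add_zero]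
    · rw [mul_comm, Nat.mul_add_mod, Nat.mod_eq_of_lt hj]
  obtain ⟨hq, hcand, hδ, hle⟩ : s₂.vars 11 < N * (N + 1) ∧
      Cand N r (Function.update (s.arrays 4) j₀ (r + 1)) (s₂.vars 11) ∧
      s₂.vars 10 = slack (weight inp M N D B) N mt (s.arrays 2) (s.arrays 3) (s₂.vars 11) ∧
      ∀ q < N * (N + 1), Cand N r (Function.update (s.arrays 4) j₀ (r + 1)) q →
        s₂.vars 10 ≤ slack (weight inp M N D B) N mt (s.arrays 2) (s.arrays 3) q := by
    rcases hmin with ⟨_, hno⟩ | ⟨_, h₁, h₂, h₃, h₄⟩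
    -- The root `N` is in the tree and some actual column is not, so this pair would have been a
    -- candidate.
    · exfalso
      have hroot : r < Function.update (s.arrays 4) j₀ (r + 1) N :=
        (hU' N).2 (h.tree.root.imp_right Eq.symm)
      obtain ⟨j, hj, hjU⟩ := h.holed.exists_not_mem (by omega) hUmem hroot
      obtain ⟨h₁, h₂, h₃⟩ := hidx N le_rfl j hj
      exact hno _ h₁ ⟨by rwa [h₂], by rwa [h₃]⟩
    · exact ⟨h₁, h₂, h₃, h₄⟩
  refine Tot.seq ((update_tot hc₂ hr₂ ?_ ?_).imp fun s₃ hf₃ hd => ?_)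
  · intro j hj
    rw [a4₂] at hj
    exact (hUmem j hj).1
  · intro j j' hj hj' e
    rw [a4₂] at hj hj'
    rw [a1₂] at e
    have m₁ := hUmem j hj
    have m₂ := hUmem j' hj'
    exact h.holed.inj j m₁.1 j' m₂.1 (by omega) (by omega) m₁.2 e
  have hc₃ := hc₂.frame hf₃ (by decide)
  rw [a1₂, a2₂, a3₂, a4₂] at hd
  have hr₃ : s₃.vars 6 = r := (hf₃.vars 6 (by decide)).trans hr₂
  have v11₃ : s₃.vars 11 = s₂.vars 11 := hf₃.vars 11 (by decide)
  have a1₃ : s₃.arrays 1 = mt := (hf₃.arrays 1 (by decide)).trans a1₂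
  have a4₃ : s₃.arrays 4 = Function.update (s.arrays 4) j₀ (r + 1) :=
    (hf₃.arrays 4 (by decide)).trans a4₂
  have a5₃ : s₃.arrays 5 = s.arrays 5 := (hf₃.arrays 5 (by decide)).trans a5₂
  refine Tot.seq (Tot.store (Tot.assign ⟨Function.update ts (s₂.vars 11 % N) (c + 1), ?_⟩))
  have hc₄ : ∀ i v, Ctx inp M N D B (s₃.setCell 5 i v) := fun i v =>
    ⟨hc₃.v1, hc₃.v2, hc₃.v3, hc₃.v4, hc₃.a0⟩
  refine ⟨⟨hc₃.v1, hc₃.v2, hc₃.v3, hc₃.v4, hc₃.a0⟩, hr₃, fun j => ?_, ?_, ?_⟩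
  · simp only [State.arrays_setVar, State.arrays_setCell]
    norm_num [a4₃]
    by_cases hj : j = j₀
    · simp [hj]
    · simpa [hj] using h.mark_le j
  · simp only [State.arrays_setVar, State.arrays_setCell]
    norm_num [a1₃]
    refine h.holed.dualStep hUmem hd fun j hj j' hj' hjU' => ?_
    obtain ⟨h₁, h₂, h₃⟩ := hidx j (hUmem j hj).1 j' hj'
    have := hle _ h₁ ⟨by rwa [h₂], by rwa [h₃]⟩
    rwa [slack, h₂, h₃] at this
  · have := Tree.extend h.holed (by omega) h.tree hmt hU' hd (Nat.mod_lt _ hNpos) hcand.2 hcand.1 hδ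
    simp only [State.arrays_setVar, State.arrays_setCell, State.vars_setVar, hc₃.colOf_val,
      (hc₄ _ _).colOf_val, hc₃.rowOf_val, Expr.val.eq_2, State.vars_setCell]
    norm_num [a1₃, a4₃, a5₃, v11₃]
    exact this

/-- The variant is the time stamp of the hole, at most `c ≤ N` at the start. Once the hole has
arrived at the virtual column, the matching is of the form needed between phases. -/
theorem augment_tot {c : ℕ} {ts : ℕ → ℕ} (h : Search inp M N D B r c ts s)
    (hmt : s.arrays 1 (s.vars 7) = 0) :
    Tot augment s (1 + N * 3) fun s' =>
      Holed M N (weight inp M N D B) (r + 1) N (s'.arrays 1) (s.arrays 2) (s.arrays 3) := by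
  have key := Tot.loop (e := .var 2 - .var 7) (s := s) (k := 2)
    (p := .seq (.store 1 (.var 7) (.get 1 (.get 5 (.var 7)))) (.assign 7 (.get 5 (.var 7))))
    (Inv := fun n s' => ts (s'.vars 7) ≤ n ∧
      Aug M N (weight inp M N D B) (r + 1) (fun j => r < s.arrays 4 j) (s.arrays 1) (s.arrays 2)
        (s.arrays 3) (s.vars 7) ts (s'.arrays 1) (s'.vars 7)) (n := c) ?_
    ⟨h.tree.ts_le _ (.inr rfl), Aug.init h.holed hmt⟩
  · refine Tot.mono (key.imp fun s' hf ⟨hz, m, _, ha⟩ => ?_) (by have := h.tree.card_le; omega)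
    have h2 : s'.vars 2 = N := (hf.vars 2 (by decide)).trans h.ctx.v2
    simp only [Expr.val_sub, Expr.val.eq_2, h2] at hz
    have hle : s'.vars 7 ≤ N := by
      rcases ha.mem with hm | hm
      · exact (h.tree.mem _ hm).1
      · rw [hm]; exact h.tree.le
    have : s'.vars 7 = N := by omega
    exact this ▸ ha.holed
  · rintro n s' hf hz ⟨hts, ha⟩
    have h2 : s'.vars 2 = N := (hf.vars 2 (by decide)).trans h.ctx.v2
    have a5 : s'.arrays 5 = s.arrays 5 := hf.arrays 5 (by decide)
    simp only [Expr.val_sub, Expr.val.eq_2, h2] at hz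
    obtain ⟨hlt, ha'⟩ := Aug.step h.tree ha (by omega)
    refine ⟨by omega, Tot.seq (Tot.store (Tot.assign ?_))⟩
    simp only [Expr.val.eq_3, Expr.val.eq_2, State.vars_setVar, State.arrays_setVar,
      State.vars_setCell, State.arrays_setCell]
    norm_num [a5]
    exact ⟨by omega, ha'⟩

/-- The state after the first `r` rows have been matched. -/
structure Matched (inp : ℕ → ℕ) (M N D B r : ℕ) (s : State) : Prop where
  ctx : Ctx inp M N D B s
  mark_le : ∀ j, s.arrays 4 j ≤ r
  holed : Holed M N (weight inp M N D B) r N (s.arrays 1) (s.arrays 2) (s.arrays 3)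

/-- A bound for the number of steps of `phase`. -/
def phaseTime (N : ℕ) : ℕ := 4 + (N + 1) * (1 + growTime N) + N * 3

theorem phase_tot (hrM : r < M) (hMN : M ≤ N) (h : Matched inp M N D B r s) (hr : s.vars 6 = r) :
    Tot phase s (phaseTime N) (Matched inp M N D B (r + 1)) := by
  refine Tot.mono (k := 1 + (1 + (1 + (N + 1) * (1 + growTime N) + (1 + N * 3)))) ?_
    (by unfold phaseTime; omega)
  refine Tot.seq (Tot.store (Tot.seq (Tot.assign (Tot.seq ?_))))
  -- As `c ≤ N` throughout, the variant `N + 1 - c` is positive whenever the loop is entered.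
  refine (Tot.loop (Inv := fun n s' => ∃ c ts, n + c = N + 1 ∧ Search inp M N D B r c ts s')
    (n := N + 1) ?_ ⟨0, fun _ => 0, rfl, ?_⟩).imp ?_
  · rintro n s' hf hz ⟨c, ts, hc, hs⟩
    have := hs.tree.card_le
    refine ⟨by omega, (grow_tot hrM hMN hs (by simpa using hz)).imp ?_⟩
    rintro s'' _ ⟨ts', hs'⟩
    exact ⟨c + 1, ts', by omega, hs'⟩
  · refine ⟨⟨h.ctx.v1, h.ctx.v2, h.ctx.v3, h.ctx.v4, h.ctx.a0⟩, hr,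
      fun j => (h.mark_le j).trans (Nat.le_succ r), ?_, ?_⟩
    · simpa [h.ctx.v2, hr] using h.holed.addRow
    -- Marks from earlier phases are at most `r`, whereas only larger ones count now; so the tree
    -- starts empty without any resetting.
    · have := fun j => (h.mark_le j).not_gt
      simp only [State.arrays_setVar, State.arrays_setCell]
      norm_num [this, h.ctx.v2, hr]
      exact Tree.init _ _ _ _
  · rintro s' hf ⟨hz, n, c, ts, hc, hs⟩
    refine (augment_tot hs (by simpa using hz)).imp fun s'' hf' hh => ?_
    refine ⟨hs.ctx.frame hf' (by decide), ?_, ?_⟩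
    · rw [hf'.arrays 4 (by decide)]
      exact hs.mark_le
    · rw [hf'.arrays 2 (by decide), hf'.arrays 3 (by decide)]
      exact hh

theorem phases_tot (hMN : M ≤ N) (h : Matched inp M N D B 0 s) :
    Tot (.forLt 6 (.var 1) phase) s (2 + M * (2 + phaseTime N)) (Matched inp M N D B M) := by
  refine Tot.forLt (n := M) (by decide) ?_ ?_ ?_
  · intro s' hf
    have := hf.vars 1 (by decide)
    simpa [this] using h.ctx.v1
  · exact ⟨⟨h.ctx.v1, h.ctx.v2, h.ctx.v3, h.ctx.v4, h.ctx.a0⟩, h.mark_le, h.holed⟩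
  · intro i hi s' hf h6 hinv
    refine (phase_tot hi hMN hinv h6).imp fun s'' _ hm => ?_
    exact ⟨⟨hm.ctx.v1, hm.ctx.v2, hm.ctx.v3, hm.ctx.v4, hm.ctx.a0⟩, hm.mark_le, hm.holed⟩

end Solver

/-! ### The common denominator, the check for missing edges, and the output. -/

namespace Solver

open Ram Hungarian

variable {inp : ℕ → ℕ} {M N D B : ℕ} {s : State}

/-- The product of the nonzero entries among the first `n` ones. -/
def commonDen (inp : ℕ → ℕ) (n : ℕ) : ℕ :=
  ∏ k ∈ Finset.range n, if inp k = 0 then 1 else inp k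

theorem commonDen_pos (inp : ℕ → ℕ) (n : ℕ) : 0 < commonDen inp n :=
  Finset.prod_pos fun k _ => by split_ifs <;> omega

theorem dvd_commonDen {n i : ℕ} (hi : i < n) (h₀ : inp i ≠ 0) : inp i ∣ commonDen inp n := by
  have := Finset.dvd_prod_of_mem (fun k => if inp k = 0 then 1 else inp k) (Finset.mem_range.2 hi)
  rw [if_neg h₀] at this
  exact this

/-- Only the positions have to differ: entries of equal value still contribute two factors. -/
theorem mul_dvd_commonDen {n i j : ℕ} (hi : i < n) (hj : j < n) (hij : i ≠ j) (hi₀ : inp i ≠ 0)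
    (hj₀ : inp j ≠ 0) : inp i * inp j ∣ commonDen inp n := by
  have hsub : ({i, j} : Finset ℕ) ⊆ Finset.range n := by
    intro k hk
    rw [Finset.mem_insert, Finset.mem_singleton] at hk
    rw [Finset.mem_range]
    omega
  have := Finset.prod_dvd_prod_of_subset _ _ (fun k => if inp k = 0 then 1 else inp k) hsub
  rw [Finset.prod_pair hij] at this
  rw [if_neg hi₀, if_neg hj₀] at this
  exact this

/-- The relation `B = 2 * D ^ 3` is maintained by three multiplications with the current input
entry; cubing `D` at the end would not be mild. -/
theorem prepare_tot {n : ℕ} (h0 : s.vars 0 = n) (ha : s.arrays 0 = inp) :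
    Tot prepare s (6 + n * 5)
      (Ctx inp (inp 0) (inp 1) (commonDen inp n) (2 * commonDen inp n ^ 3)) := by
  refine Tot.mono (k := 1 + (1 + (1 + (1 + (2 + n * (2 + 3)))))) ?_ (by omega)
  refine Tot.seq (Tot.assign (Tot.seq (Tot.assign (Tot.seq (Tot.assign (Tot.seq (Tot.assign ?_)))))))
  refine Tot.forLt (n := n)
    (Inv := fun i s' => Ctx inp (inp 0) (inp 1) (commonDen inp i) (2 * commonDen inp i ^ 3) s')
    (by decide) ?_ ?_ ?_
  · intro s' hf
    have := hf.vars 0 (by decide)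
    simpa [h0] using this
  · constructor <;> simp [ha, commonDen]
  · intro i hi s' hf h5 hinv
    have hsucc : commonDen inp (i + 1) = commonDen inp i * if inp i = 0 then 1 else inp i :=
      Finset.prod_range_succ _ _
    refine Tot.ite (fun hc => ?_) (fun hc => ?_)
    · simp only [Expr.val.eq_3, Expr.val.eq_2, h5, hinv.a0] at hc
      rw [if_neg hc] at hsucc
      refine Tot.seq (k := 1) (k' := 1) (Tot.assign (Tot.assign ⟨?_, ?_, ?_, ?_, ?_⟩))
      · simpa using hinv.v1
      · simpa using hinv.v2
      · simp [hinv.v3, hinv.a0, h5, hsucc]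
      · simp [hinv.v4, hinv.a0, h5, hsucc]
        ring
      · simpa using hinv.a0
    · simp only [Expr.val.eq_3, Expr.val.eq_2, h5, hinv.a0] at hc
      rw [if_pos hc, mul_one] at hsucc
      refine Tot.mono (Tot.skip ?_) (by omega : 1 ≤ 2)
      rw [hsucc]
      exact ⟨hinv.v1, hinv.v2, hinv.v3, hinv.v4, hinv.a0⟩

/-- `1` if the column `q % N` is matched to the row `q / N`, otherwise `0`. -/
def matchFlag (N : ℕ) (mt : ℕ → ℕ) (q : ℕ) : ℕ := if mt (q % N) = q / N + 1 then 1 else 0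

/-- The sum of the two opposite truncated differences is `0` exactly in case of equality. -/
theorem Ctx.matchedExpr_val (h : Ctx inp M N D B s) (q : Expr) :
    (matchedExpr q).val s = matchFlag N (s.arrays 1) (q.val s) := by
  simp only [matchedExpr, matchFlag, Expr.val_sub, Expr.val_add, Expr.val_one, Expr.val.eq_3,
    h.colOf_val, h.rowOf_val]
  split_ifs <;> omega

theorem checkMissing_tot (h : Ctx inp M N D B s) :
    Tot checkMissing s (3 + M * N * 4) fun s' => s'.vars 13 = 0 ↔
      ∀ q < M * N, s.arrays 1 (q % N) = q / N + 1 → inp (2 + 2 * q) ≠ 0 := by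
  refine Tot.mono (k := 1 + (2 + M * N * (2 + 2))) ?_ (by omega)
  refine Tot.seq (Tot.assign ?_)
  refine Tot.forLt (n := M * N)
    (Inv := fun i s' => s'.vars 13 = 0 ↔
      ∀ q < i, s.arrays 1 (q % N) = q / N + 1 → inp (2 + 2 * q) ≠ 0) (by decide) ?_ ?_ ?_
  · intro s' hf
    have h₁ := hf.vars 1 (by decide)
    have h₂ := hf.vars 2 (by decide)
    simp at h₁ h₂
    simp [h₁, h₂, h.v1, h.v2]
  · simp
  · intro i hi s' hf h8 hinv
    have h' : Ctx inp M N D B s' :=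
      Ctx.frame (s := s.setVar 13 0) ⟨h.v1, h.v2, h.v3, h.v4, h.a0⟩ hf (by decide)
    have a1 : s'.arrays 1 = s.arrays 1 := hf.arrays 1 (by decide)
    have hval : (matchedExpr (.var 8) * (1 - slopeNum (.var 8))).val s' =
        matchFlag N (s.arrays 1) i * (1 - inp (2 + 2 * i)) := by
      simp [h'.matchedExpr_val, slopeNum, h'.a0, h8, a1]
    refine Tot.ite (fun hc => Tot.assign ?_) (fun hc => Tot.skip ?_)
    · rw [hval, mul_ne_zero_iff] at hc
      have hm : s.arrays 1 (i % N) = i / N + 1 := by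
        by_contra hne
        simp [matchFlag, hne] at hc
      simp only [State.vars_setVar]
      norm_num
      exact ⟨i, by omega, hm, by omega⟩
    · rw [hval, mul_eq_zero] at hc
      simp only [State.vars_setVar]
      norm_num [hinv]
      constructor
      · intro hall q hq hm
        rcases Nat.lt_succ_iff_lt_or_eq.1 (Nat.lt_succ_of_le hq) with hq | rfl
        · exact hall q hq hm
        · simp only [matchFlag, if_pos hm] at hc
          omega
      · exact fun hall q hq => hall q hq.le

/-- The denominator in the output. -/
def outDen (inp : ℕ → ℕ) (M N : ℕ) (mt : ℕ → ℕ) (q : ℕ) : ℕ :=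
  inp (3 + 2 * (M * N) + 2 * (q / N)) * inp (2 + 2 * q) + (1 - matchFlag N mt q)

/-- The numerator in the output. -/
def outNum (inp : ℕ → ℕ) (M N : ℕ) (q : ℕ) : ℕ :=
  inp (2 + 2 * (M * N) + 2 * (q / N)) * inp (3 + 2 * q)

theorem emitAll_tot (h : Ctx inp M N D B s) :
    Tot emitAll s (3 + M * N * 5) fun s' => s'.output = s.output ++ 1 ::
      (List.range (M * N)).flatMap fun q =>
        [matchFlag N (s.arrays 1) q, outNum inp M N q, outDen inp M N (s.arrays 1) q] := by
  refine Tot.mono (k := 1 + (2 + M * N * (2 + (1 + (1 + 1))))) ?_ (by omega)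
  refine Tot.seq (Tot.emit ?_)
  refine Tot.forLt (n := M * N)
    (Inv := fun i s' => s'.output = s.output ++ 1 ::
      (List.range i).flatMap fun q =>
        [matchFlag N (s.arrays 1) q, outNum inp M N q, outDen inp M N (s.arrays 1) q])
    (by decide) ?_ ?_ ?_
  · intro s' hf
    have h₁ : s'.vars 1 = M := (hf.vars 1 (by decide)).trans h.v1
    have h₂ : s'.vars 2 = N := (hf.vars 2 (by decide)).trans h.v2
    simp [h₁, h₂]
  · simp
  · intro i hi s' hf h8 hinv
    have h' : Ctx inp M N D B s' :=
      Ctx.frame (s := s.emit 1) ⟨h.v1, h.v2, h.v3, h.v4, h.a0⟩ hf (by decide)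
    have a1 : s'.arrays 1 = s.arrays 1 := hf.arrays 1 (by decide)
    refine Tot.seq (Tot.emit (Tot.seq (Tot.emit (Tot.emit ?_))))
    have hc : ∀ v, Ctx inp M N D B (s'.emit v) := fun v => ⟨h'.v1, h'.v2, h'.v3, h'.v4, h'.a0⟩
    have hcc : ∀ v v', Ctx inp M N D B ((s'.emit v).emit v') := fun v v' =>
      ⟨h'.v1, h'.v2, h'.v3, h'.v4, h'.a0⟩
    simp [hinv, List.range_succ, h'.matchedExpr_val, (hcc _ _).matchedExpr_val, targetNum,
      targetDen, slopeNum, slopeDen, (hc _).rowOf_val, (hcc _ _).rowOf_val, h'.a0, h'.v1, h'.v2,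
      h8, a1, outNum, outDen]

/-! ### The input -/

theorem flatMap_finRange {α : Type*} {n : ℕ} (f : Fin n → List α) (g : ℕ → List α)
    (h : ∀ i, f i = g i) : (List.finRange n).flatMap f = (List.range n).flatMap g := by
  rw [← List.map_coe_finRange_eq_range, List.flatMap_map]
  exact congrArg (fun F => List.flatMap F _) (funext h)

theorem flatMap_finRange_finRange {α : Type*} {M N : ℕ} (f : Fin M → Fin N → List α)
    (g : ℕ → List α) (h : ∀ m n, f m n = g (m * N + n)) :
    ((List.finRange M).flatMap fun m => (List.finRange N).flatMap fun n => f m n) =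
      (List.range (M * N)).flatMap g := by
  have : ∀ K, ((List.range K).flatMap fun m => (List.range N).flatMap fun n => g (m * N + n)) =
      (List.range (K * N)).flatMap g := by
    intro K
    induction K with
    | zero => simp
    | succ K ih =>
      rw [List.range_succ, List.flatMap_append, ih, Nat.succ_mul, List.range_add,
        List.flatMap_append, List.flatMap_map]
      simp
  rw [← this, flatMap_finRange _ (fun m => (List.range N).flatMap fun n => g (m * N + n))]
  exact fun m => flatMap_finRange _ _ fun n => h m n

theorem length_flatMap_pair (a b : ℕ → ℕ) (K : ℕ) :
    ((List.range K).flatMap fun q => [a q, b q]).length = 2 * K := by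
  simp [List.length_flatMap, mul_comm]

theorem getD_flatMap_pair (a b : ℕ → ℕ) {K q : ℕ} (hq : q < K) :
    ((List.range K).flatMap fun q => [a q, b q]).getD (2 * q) 0 = a q ∧
      ((List.range K).flatMap fun q => [a q, b q]).getD (2 * q + 1) 0 = b q := by
  induction K with
  | zero => omega
  | succ K ih =>
    rw [List.range_succ, List.flatMap_append]
    rcases Nat.lt_succ_iff_lt_or_eq.1 hq with hq | rfl
    · rw [List.getD_append _ _ _ _ (by rw [length_flatMap_pair]; omega),
        List.getD_append _ _ _ _ (by rw [length_flatMap_pair]; omega)]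
      exact ih hq
    · rw [List.getD_append_right _ _ _ _ (by rw [length_flatMap_pair]),
        List.getD_append_right _ _ _ _ (by rw [length_flatMap_pair]; omega), length_flatMap_pair]
      simp

/-- The entries of the input. -/
structure Reads (I : LinearInstance) (inp : ℕ → ℕ) : Prop where
  users : inp 0 = I.M
  channels : inp 1 = I.N
  slope : ∀ (m : Fin I.M) (n : Fin I.N), inp (2 + 2 * (m * I.N + n)) = (I.ℓ m n).num ∧
    inp (3 + 2 * (m * I.N + n)) = (I.ℓ m n).den
  target : ∀ m : Fin I.M, inp (2 + 2 * (I.M * I.N) + 2 * m) = (I.R m).num ∧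
    inp (3 + 2 * (I.M * I.N) + 2 * m) = (I.R m).den

theorem index_lt {M N m n : ℕ} (hm : m < M) (hn : n < N) : m * N + n < M * N := by
  calc m * N + n < m * N + N := by omega
    _ = (m + 1) * N := by ring
    _ ≤ M * N := Nat.mul_le_mul_right _ hm

theorem index_div {N m n : ℕ} (hn : n < N) : (m * N + n) / N = m := by
  rw [mul_comm, Nat.mul_add_div (by omega), Nat.div_eq_of_lt hn, add_zero]

theorem index_mod {N m n : ℕ} (hn : n < N) : (m * N + n) % N = n := by
  rw [mul_comm, Nat.mul_add_mod, Nat.mod_eq_of_lt hn]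

theorem encode_spec (I : LinearInstance) : ∃ inp : ℕ → ℕ, (∀ k, I.encode.getD k 0 = inp k) ∧
    Reads I inp ∧ I.encode.length = 2 + 2 * (I.M * I.N) + 2 * I.M := by
  let f : (ℚ≥0 → ℕ) → ℕ → ℕ := fun F q =>
    if h : q / I.N < I.M ∧ q % I.N < I.N then F (I.ℓ ⟨_, h.1⟩ ⟨_, h.2⟩) else 0
  let g : (ℚ≥0 → ℕ) → ℕ → ℕ := fun F m => if h : m < I.M then F (I.R ⟨m, h⟩) else 0
  have hf : ∀ F (m : Fin I.M) (n : Fin I.N), f F (m.val * I.N + n.val) = F (I.ℓ m n) := by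
    intro F m n
    simp [f, index_div n.2, index_mod n.2]
  have hg : ∀ F (m : Fin I.M), g F m.val = F (I.R m) := by
    intro F m
    simp [g]
  have henc : I.encode = [I.M, I.N] ++
      ((List.range (I.M * I.N)).flatMap fun q => [f NNRat.num q, f NNRat.den q]) ++
      ((List.range I.M).flatMap fun m => [g NNRat.num m, g NNRat.den m]) := by
    rw [LinearInstance.encode]
    congr 1
    · congr 1
      exact flatMap_finRange_finRange _ _ fun m n => by rw [hf, hf]
    · exact flatMap_finRange _ _ fun m => by rw [hg, hg]
  have hlen : ([I.M, I.N] ++ ((List.range (I.M * I.N)).flatMap fun q =>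
      [f NNRat.num q, f NNRat.den q])).length = 2 + 2 * (I.M * I.N) := by
    rw [List.length_append, length_flatMap_pair]
    rfl
  refine ⟨fun k => I.encode.getD k 0, fun k => rfl, ⟨?_, ?_, fun m n => ?_, fun m => ?_⟩, ?_⟩
  · simp [henc]
  · simp [henc]
  · have hq := index_lt m.2 n.2
    obtain ⟨h₁, h₂⟩ := getD_flatMap_pair (f NNRat.num) (f NNRat.den) hq
    rw [hf] at h₁ h₂
    constructor
    · rw [henc, List.getD_append _ _ _ _ (by rw [hlen]; omega),
        List.getD_append_right _ _ _ _ (by simp), ← h₁]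
      congr 1
      simp
    · rw [henc, List.getD_append _ _ _ _ (by rw [hlen]; omega),
        List.getD_append_right _ _ _ _ (by simp; omega), ← h₂]
      congr 1
      simp
      omega
  · obtain ⟨h₁, h₂⟩ := getD_flatMap_pair (g NNRat.num) (g NNRat.den) m.2
    rw [hg] at h₁ h₂
    rw [henc, List.getD_append_right _ _ _ _ (by rw [hlen]; omega),
      List.getD_append_right _ _ _ _ (by rw [hlen]; omega), hlen]
    refine ⟨?_, ?_⟩
    · rw [← h₁]; congr 1; omega
    · rw [← h₂]; congr 1; omega
  · rw [henc, List.length_append, hlen, length_flatMap_pair]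

end Solver

/-- The program emits fractions for all pairs; those of unmatched pairs carry no meaning, and this
makes them irrelevant. -/
theorem MPCA.IsFeasible.congr {M N : ℕ} {I : MPCA M N} {a b : Allocation M N}
    (h : I.IsFeasible a) (hc : b.chan = a.chan)
    (hp : ∀ m, ∀ n ∈ a.chan m, b.power m n = a.power m n) : I.IsFeasible b := by
  refine ⟨fun m m' hne => ?_, fun m n hn => ?_, fun m => ?_⟩
  · rw [hc]
    exact h.disjoint m m' hne
  · rw [hc] at hn
    rw [hp m n hn]
    exact h.power_nonneg m n hn
  · rw [hc, Finset.sum_congr rfl fun n hn => by rw [hp m n hn]]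
    exact h.target_le m

/-! ### From integral weights to a correct answer. -/

namespace Solver

open Ram Hungarian

variable {I : LinearInstance} {inp mt u p : ℕ → ℕ} {L : ℕ}

/-- The weights of the assignment problem that the program solves. -/
abbrev scaledCost (I : LinearInstance) (inp : ℕ → ℕ) (L : ℕ) : ℕ → ℕ → ℕ :=
  weight inp I.M I.N (commonDen inp L) (2 * commonDen inp L ^ 3)

/-- Division by the numerator `0` yields `0`, so the first term vanishes, and the correction `B - B
* 0` is all of `B`. -/
theorem scaledCost_of_eq_zero (h : Reads I inp) {m : Fin I.M} {n : Fin I.N} (h₀ : I.ℓ m n = 0) :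
    scaledCost I inp L m n = 2 * commonDen inp L ^ 3 := by
  simp [weight, (h.slope m n).1, h₀]

/-- The correction `B - B * num` is truncated to `0`. The remaining divisor and the remaining factor
are each a product of two input entries and divide `D`: hence the division is exact, and both the
quotient and the factor are at most `D`. -/
theorem scaledCost_of_ne_zero (h : Reads I inp)
    (hL : L = 2 + 2 * (I.M * I.N) + 2 * I.M) {m : Fin I.M} {n : Fin I.N} (h₀ : I.ℓ m n ≠ 0) :
    (scaledCost I inp L m n : ℝ) = commonDen inp L * ((I.R m : ℝ) / (I.ℓ m n : ℝ)) ∧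
      scaledCost I inp L m n ≤ commonDen inp L ^ 2 := by
  obtain ⟨h₁, h₂⟩ := h.slope m n
  obtain ⟨h₃, h₄⟩ := h.target m
  have hm := m.2
  have hlt := index_lt m.2 n.2
  have hnum : (I.ℓ m n).num ≠ 0 := by simpa using h₀
  have hnum' : (I.R m).num ≠ 0 := by simpa using (I.R_pos m).ne'
  have hden := (I.ℓ m n).den_pos
  have hden' := (I.R m).den_pos
  have hdvd : (I.R m).den * (I.ℓ m n).num ∣ commonDen inp L := by
    rw [← h₁, ← h₄]
    exact mul_dvd_commonDen (by omega) (by omega) (by omega) (by rw [h₄]; omega)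
      (by rw [h₁]; exact hnum)
  have hdvd' : (I.R m).num * (I.ℓ m n).den ∣ commonDen inp L := by
    rw [← h₂, ← h₃]
    exact mul_dvd_commonDen (by omega) (by omega) (by omega) (by rw [h₃]; exact hnum')
      (by rw [h₂]; omega)
  have hw : scaledCost I inp L m n =
      commonDen inp L / ((I.R m).den * (I.ℓ m n).num) * ((I.R m).num * (I.ℓ m n).den) := by
    have : 2 * commonDen inp L ^ 3 - 2 * commonDen inp L ^ 3 * (I.ℓ m n).num = 0 :=
      Nat.sub_eq_zero_of_le (Nat.le_mul_of_pos_right _ (Nat.pos_of_ne_zero hnum))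
    simp only [scaledCost, weight, h₁, h₂, h₃, h₄, this, Nat.div_div_eq_div_mul]
    ring
  constructor
  · rw [hw, Nat.cast_mul, Nat.cast_div hdvd (by
      simpa using h₀)]
    rw [NNRat.cast_def (I.R m), NNRat.cast_def (I.ℓ m n)]
    have e₁ : ((I.ℓ m n).num : ℝ) ≠ 0 := by exact_mod_cast hnum
    have e₂ : ((I.ℓ m n).den : ℝ) ≠ 0 := by exact_mod_cast hden.ne'
    have e₃ : ((I.R m).den : ℝ) ≠ 0 := by exact_mod_cast hden'.ne'
    push_cast
    field_simp
  · rw [hw, sq]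
    exact Nat.mul_le_mul (Nat.div_le_self _ _) (Nat.le_of_dvd (commonDen_pos _ _) hdvd')

/-- The hole is the virtual column, so the column of every row is an actual channel. -/
theorem exists_assignment {M N : ℕ} {w : ℕ → ℕ → ℕ} (h : Holed M N w M N mt u p) :
    ∃ σ : Fin M → Fin N, ∀ (m : Fin M) (n : Fin N), mt n = m + 1 ↔ n = σ m := by
  have : ∀ m : Fin M, ∃ n : Fin N, mt n = m + 1 := fun m => by
    obtain ⟨j, hj, hjN, hm⟩ := h.cov (m + 1) (by omega) (by omega)
    exact ⟨⟨j, by omega⟩, hm⟩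
  choose σ hσ using this
  refine ⟨σ, fun m n => ⟨fun hn => ?_, fun hn => hn ▸ hσ m⟩⟩
  exact Fin.ext (h.inj n n.2.le (σ m) (σ m).2.le n.2.ne (σ m).2.ne (by omega) (by rw [hn, hσ]))

theorem realSlope_pos_iff (m : Fin I.M) (n : Fin I.N) : 0 < (I.ℓ m n : ℝ) ↔ I.ℓ m n ≠ 0 := by
  rw [← NNRat.cast_zero, NNRat.cast_lt, pos_iff_ne_zero]

theorem realTarget_pos (m : Fin I.M) : 0 < (I.R m : ℝ) := by
  rw [← NNRat.cast_zero, NNRat.cast_lt]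
  exact I.R_pos m

theorem realSlope_nonneg (m : Fin I.M) (n : Fin I.N) : 0 ≤ (I.ℓ m n : ℝ) := NNRat.cast_nonneg _

/-- The matching uses a missing edge only if the instance is infeasible. -/
theorem not_exists_isFeasible (h : Reads I inp) (hL : L = 2 + 2 * (I.M * I.N) + 2 * I.M)
    (hh : Holed I.M I.N (scaledCost I inp L) I.M I.N mt u p) {σ : Fin I.M → Fin I.N}
    (hσ : ∀ (m : Fin I.M) (n : Fin I.N), mt n = m.val + 1 ↔ n = σ m) {m : Fin I.M} (hm : I.ℓ m (σ m) = 0) :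
    ¬ ∃ a, I.toMPCA.IsFeasible a := by
  rintro ⟨a, ha⟩
  obtain ⟨τ, hτ, _⟩ := MPCA.IsFeasible.exists_singleChannel realTarget_pos realSlope_nonneg ha
  obtain ⟨hinj, hpos⟩ := (singleChannel_isFeasible_iff realTarget_pos realSlope_nonneg τ).1 hτ
  have h₁ := hh.isMin (fun m => (hσ m _).2 rfl) hinj
  have h₂ : scaledCost I inp L m (σ m) ≤ ∑ m : Fin I.M, scaledCost I inp L m (σ m) :=
    Finset.single_le_sum (f := fun m : Fin I.M => scaledCost I inp L m (σ m))
      (fun _ _ => Nat.zero_le _) (Finset.mem_univ m)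
  rw [scaledCost_of_eq_zero h hm] at h₂
  have h₃ : ∑ m : Fin I.M, scaledCost I inp L m (τ m) ≤ I.M * commonDen inp L ^ 2 := by
    refine (Finset.sum_le_card_nsmul _ _ (commonDen inp L ^ 2) fun m _ => ?_).trans ?_
    · exact (scaledCost_of_ne_zero h hL ((realSlope_pos_iff m (τ m)).1 (hpos m))).2
    · simp
  -- `M` is itself a nonzero input entry, hence a factor of `D`. So the weight of `τ` is at most `M
  -- * D ^ 2 ≤ D ^ 3`, less than one missing edge.
  have h₄ : I.M ≤ commonDen inp L := by
    have hm := m.2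
    rw [← h.users]
    exact Nat.le_of_dvd (commonDen_pos _ _) (dvd_commonDen (by omega) (by rw [h.users]; omega))
  have h₅ := Nat.mul_le_mul_right (commonDen inp L ^ 2) h₄
  have h₆ : 0 < commonDen inp L ^ 3 := pow_pos (commonDen_pos _ _) 3
  have h₇ : commonDen inp L * commonDen inp L ^ 2 = commonDen inp L ^ 3 := by ring
  omega

/-- The matching gives an optimal allocation if it uses no missing edge. -/
theorem isOptimal_of_matching (h : Reads I inp) (hL : L = 2 + 2 * (I.M * I.N) + 2 * I.M)
    (hh : Holed I.M I.N (scaledCost I inp L) I.M I.N mt u p) {σ : Fin I.M → Fin I.N}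
    (hσ : ∀ (m : Fin I.M) (n : Fin I.N), mt n = m.val + 1 ↔ n = σ m) (hne : ∀ m, I.ℓ m (σ m) ≠ 0)
    {a : Allocation I.M I.N} (hchan : ∀ m, a.chan m = {σ m})
    (hpow : ∀ m, a.power m (σ m) = I.R m / I.ℓ m (σ m)) : I.toMPCA.IsOptimal a := by
  have hinj : Function.Injective σ := fun m m' e => by
    have h₁ := (hσ m (σ m)).2 rfl
    have h₂ := (hσ m' (σ m')).2 rfl
    rw [e] at h₁
    exact Fin.ext (by omega)
  have hfeas : I.toMPCA.IsFeasible a := by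
    refine ((singleChannel_isFeasible_iff realTarget_pos realSlope_nonneg σ).2
      ⟨hinj, fun m => (realSlope_pos_iff m _).2 (hne m)⟩).congr (funext hchan) fun m n hn => ?_
    rw [Finset.mem_singleton.1 hn]
    exact hpow m
  refine isOptimal_of_forall_singleChannel realTarget_pos realSlope_nonneg hfeas
    fun τ hτ hpos => ?_
  have htot : a.totalPower = ∑ m, (I.R m : ℝ) / I.ℓ m (σ m) := by
    simp [Allocation.totalPower, Allocation.userPower, hchan, hpow]
  have hmin : (∑ m : Fin I.M, (scaledCost I inp L m (σ m) : ℝ)) ≤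
      ∑ m : Fin I.M, (scaledCost I inp L m (τ m) : ℝ) := by
    exact_mod_cast hh.isMin (fun m => (hσ m _).2 rfl) hτ
  -- Neither matching uses a missing edge, so both weights are `D` times the power, and `D > 0`
  -- cancels.
  rw [Finset.sum_congr rfl fun m _ => (scaledCost_of_ne_zero h hL (hne m)).1,
    Finset.sum_congr rfl fun m _ =>
      (scaledCost_of_ne_zero h hL ((realSlope_pos_iff m (τ m)).1 (hpos m))).1,
    ← Finset.mul_sum, ← Finset.mul_sum] at hmin
  rw [htot]
  exact le_of_mul_le_mul_left hmin (by exact_mod_cast commonDen_pos inp L)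

/-- A bound for the number of steps of the program. -/
def solveTime (L : ℕ) : ℕ := 40 + L * 14 + L * (2 + phaseTime L)

theorem phaseTime_mono {N N' : ℕ} (h : N ≤ N') : phaseTime N ≤ phaseTime N' := by
  unfold phaseTime growTime
  gcongr

theorem solve_tot (h : Reads I inp) (hL : L = 2 + 2 * (I.M * I.N) + 2 * I.M) {s : State}
    (hs0 : s.vars 0 = L) (ha0 : s.arrays 0 = inp)
    (ha : ∀ A, A ≠ 0 → ∀ i, s.arrays A i = 0) (hout : s.output = []) :
    Tot solve s (solveTime L) fun s' => I.IsAnswer s'.output := by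
  refine Tot.mono (k := (6 + L * 5) + ((2 + I.M * (2 + phaseTime I.N)) +
    ((3 + I.M * I.N * 4) + ((3 + I.M * I.N * 5) + 1)))) ?_ ?_
  · refine Tot.seq ((prepare_tot hs0 ha0).imp fun s₁ hf₁ hc₁ => ?_)
    rw [h.users, h.channels] at hc₁
    have a1 : ∀ A, A ≠ 0 → prepare.setsArray A = false → ∀ i, s₁.arrays A i = 0 := by
      intro A hA hp i
      rw [hf₁.arrays A hp]
      exact ha A hA i
    have hm₁ : Matched inp I.M I.N (commonDen inp L) (2 * commonDen inp L ^ 3) 0 s₁ :=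
      ⟨hc₁, fun j => (a1 4 (by decide) (by decide) j).le,
        Holed.init _ _ (a1 2 (by decide) (by decide)) (a1 3 (by decide) (by decide))
          (a1 1 (by decide) (by decide))⟩
    refine Tot.seq ((phases_tot I.le hm₁).imp fun s₂ hf₂ hm₂ => ?_)
    refine Tot.seq ((checkMissing_tot hm₂.ctx).imp fun s₃ hf₃ h13 => ?_)
    have hout₃ : s₃.output = [] := by
      rw [hf₃.output (by decide), hf₂.output (by decide), hf₁.output (by decide), hout]
    have hc₃ := hm₂.ctx.frame hf₃ (by decide)
    have a1₃ : s₃.arrays 1 = s₂.arrays 1 := hf₃.arrays 1 (by decide)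
    set mt := s₂.arrays 1
    obtain ⟨σ, hσ⟩ : ∃ σ : Fin I.M → Fin I.N, ∀ (m : Fin I.M) (n : Fin I.N),
        mt n = m + 1 ↔ n = σ m := exists_assignment hm₂.holed
    refine Tot.ite (fun hne => ?_) (fun he => ?_)
    · refine Tot.mono (Tot.emit (.inr ⟨?_, by simp [hout₃]⟩)) (by omega : 1 ≤ 3 + I.M * I.N * 5)
      simp only [Expr.val.eq_2, ne_eq, h13] at hne
      push Not at hne
      obtain ⟨q, hq, hmq, hzero⟩ := hne
      have hN : 0 < I.N := Nat.pos_of_ne_zero fun e => by simp [e] at hq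
      have hqM : q / I.N < I.M := (Nat.div_lt_iff_lt_mul hN).2 hq
      have hqN := Nat.mod_lt q hN
      have hσq : (⟨q % I.N, hqN⟩ : Fin I.N) = σ ⟨q / I.N, hqM⟩ := (hσ _ _).1 hmq
      refine not_exists_isFeasible h hL hm₂.holed hσ (m := ⟨q / I.N, hqM⟩) ?_
      rw [← hσq]
      have := (h.slope ⟨q / I.N, hqM⟩ ⟨q % I.N, hqN⟩).1
      simp only [Nat.div_add_mod' q I.N, hzero] at this
      by_contra h₀
      exact absurd this.symm (by simpa using h₀)
    · simp only [Expr.val.eq_2, h13] at he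
      have hne : ∀ m, I.ℓ m (σ m) ≠ 0 := by
        intro m h₀
        refine he (m * I.N + σ m) (index_lt m.2 (σ m).2) ?_ ?_
        · rw [index_mod (σ m).2, index_div (σ m).2]
          exact (hσ m _).2 rfl
        · rw [(h.slope m (σ m)).1, h₀]
          rfl
      refine (emitAll_tot hc₃).imp fun s₄ _ hout₄ => .inl ?_
      have hflag : ∀ (m : Fin I.M) (n : Fin I.N),
          matchFlag I.N mt (m * I.N + n) = if n = σ m then 1 else 0 := fun m n => by
        simp only [matchFlag, index_mod n.2, index_div n.2, hσ]
      have hden : ∀ (m : Fin I.M) (n : Fin I.N), outDen inp I.M I.N mt (m * I.N + n) =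
          (I.R m).den * (I.ℓ m n).num + (1 - if n = σ m then 1 else 0) := fun m n => by
        rw [outDen, hflag, index_div n.2, (h.slope m n).1, (h.target m).2]
      have hnum : ∀ (m : Fin I.M) (n : Fin I.N), outNum inp I.M I.N (m * I.N + n) =
          (I.R m).num * (I.ℓ m n).den := fun m n => by
        rw [outNum, index_div n.2, (h.slope m n).2, (h.target m).1]
      refine ⟨fun m => {σ m}, fun m n => outNum inp I.M I.N (m * I.N + n),
        fun m n => outDen inp I.M I.N mt (m * I.N + n), fun m n => ?_, ?_, ?_⟩
      · dsimp only
        rw [hden]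
        by_cases hn : n = σ m
        · have : 0 < (I.ℓ m n).num := Nat.pos_of_ne_zero (by simpa [hn] using hne m)
          have := Nat.mul_pos (I.R m).den_pos this
          omega
        · simp [hn]
      · rw [hout₄, hout₃, a1₃, encodeAllocation, List.nil_append]
        congr 1
        symm
        refine flatMap_finRange_finRange _ _ fun m n => ?_
        simp only [hflag, Finset.mem_singleton]
      · refine isOptimal_of_matching h hL hm₂.holed hσ hne (fun m => rfl) fun m => ?_
        dsimp only
        rw [hnum, hden, if_pos rfl, NNRat.cast_def (I.R m), NNRat.cast_def (I.ℓ m (σ m))]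
        have e₁ : ((I.ℓ m (σ m)).num : ℝ) ≠ 0 := by
          have : (I.ℓ m (σ m)).num ≠ 0 := by simpa using hne m
          exact_mod_cast this
        have e₂ : ((I.ℓ m (σ m)).den : ℝ) ≠ 0 := by exact_mod_cast (I.ℓ m (σ m)).den_pos.ne'
        have e₃ : ((I.R m).den : ℝ) ≠ 0 := by exact_mod_cast (I.R m).den_pos.ne'
        push_cast
        field_simp
        ring
  · have h₁ : I.M * (2 + phaseTime I.N) ≤ L * (2 + phaseTime L) := by
      -- For `M = 0` the number `N` is not bounded by the input length, as it occurs only as one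
      -- entry, but then there are no phases. Otherwise `N ≤ M * N ≤ L`.
      rcases Nat.eq_zero_or_pos I.M with hM | hM
      · simp [hM]
      · have : I.N ≤ I.M * I.N := Nat.le_mul_of_pos_left _ hM
        exact Nat.mul_le_mul (by omega) (Nat.add_le_add_left (phaseTime_mono (by omega)) 2)
    unfold solveTime
    omega

/-! ### Polynomial bounds in the input size. -/

theorem length_le_inputSize (l : List ℕ) : l.length ≤ inputSize l := by
  induction l with
  | nil => simp
  | cons k l ih => simp only [inputSize, List.map_cons, List.sum_cons, List.length_cons] at *; omega

theorem size_getD_le_inputSize (l : List ℕ) (i : ℕ) : (l.getD i 0).size ≤ inputSize l := by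
  induction l generalizing i with
  | nil => simp
  | cons k l ih =>
    cases i with
    | zero => simp [inputSize]; omega
    | succ i =>
      have := ih i
      simp only [inputSize, List.map_cons, List.sum_cons, List.getD_cons_succ] at *
      omega

theorem start_sizeLE (l : List ℕ) : (start l).SizeLE (inputSize l) := by
  constructor
  · intro x
    by_cases hx : x = 0
    · subst hx
      refine le_trans ?_ (length_le_inputSize l)
      simpa [start, Nat.size_le] using Nat.lt_two_pow_self
    · simp [start, hx]
  · intro A i
    by_cases hA : A = 0
    · subst hA
      simpa [start] using size_getD_le_inputSize l i
    · simp [start, hA]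

theorem solveTime_mono {L L' : ℕ} (h : L ≤ L') : solveTime L ≤ solveTime L' := by
  have := phaseTime_mono h
  unfold solveTime
  gcongr

theorem solvableInPolyTime :
    SolvableInPolyTime LinearInstance.encode LinearInstance.IsAnswer := by
  let T : Polynomial ℕ := 40 + .X * 14 + .X * (2 + (4 + (.X + 1) *
    (1 + (8 + .X * (.X + 1) * 6 + (.X + 1) * 5)) + .X * 3))
  have hT : ∀ x, T.eval x = solveTime x := by
    intro x
    simp [T, solveTime, phaseTime, growTime]
  -- This is `costBound` after `T` steps, with the input size as the bound both for all initial
  -- values and for the input entries.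
  let q : Polynomial ℕ := T * (1 + .C solve.len * (1 + .C solve.len *
    ((.X + T * (.C solve.len * (.X + 1))) + 1)))
  have hq : ∀ x, q.eval x =
      costBound solve.len (x + solveTime x * (solve.len * (x + 1))) (solveTime x) := by
    intro x
    simp [q, hT, costBound]
  refine ⟨solve, q, fun I => ?_⟩
  obtain ⟨inp, hinp, hr, hlen⟩ := encode_spec I
  have htot := solve_tot hr hlen (s := start I.encode) rfl
    (funext fun i => by rw [← hinp]; simp [start])
    (fun A hA i => by simp [start, hA]) rfl
  obtain ⟨s', k, hk, hrun, hans⟩ := htot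
  have hk' := hk.trans (solveTime_mono (length_le_inputSize I.encode))
  have hsize := start_sizeLE I.encode
  obtain ⟨_, _, t, hexec, ht⟩ := hrun.exec (L := solve.len) solve_mild le_rfl hsize (hsize.arrays 0)
  refine ⟨s', t, hexec, ht.trans ?_, hans⟩
  rw [hq]
  unfold costBound
  gcongr

end Solver

theorem theorem2 :
    -- polynomial-time solvability
    Ram.SolvableInPolyTime LinearInstance.encode LinearInstance.IsAnswer ∧
    -- the structure of the optimum, for real data
    ∀ (M N : ℕ) (hMN : M ≤ N) (ℓ : Fin M → Fin N → ℝ) (R : Fin M → ℝ),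
      (∀ m n, 0 ≤ ℓ m n) → (∀ m, 0 < R m) →
      -- within any feasible channel partitioning, it is optimal for each user to put the whole
      -- rate on a single one of its channels, namely on any one of largest slope
      (∀ a : Allocation M N, (linearMPCA ℓ R).IsFeasible a →
        (∀ m, ∃ n ∈ a.chan m, ∀ n' ∈ a.chan m, ℓ m n' ≤ ℓ m n) ∧
        ∀ σ : Fin M → Fin N, (∀ m, σ m ∈ a.chan m ∧ ∀ n ∈ a.chan m, ℓ m n ≤ ℓ m (σ m)) →
          (linearMPCA ℓ R).IsFeasible (singleChannel ℓ R σ) ∧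
          ∀ m, (singleChannel ℓ R σ).userPower m ≤ a.userPower m) ∧
      -- if the instance is feasible, some optimal allocation uses a single channel per user
      ((∃ a, (linearMPCA ℓ R).IsFeasible a) →
        ∃ σ : Fin M → Fin N, (linearMPCA ℓ R).IsOptimal (singleChannel ℓ R σ)) ∧
      -- equivalence with the minimum-cost assignment problem: feasibility, optimal solutions,
      -- and optimal values
      ((∃ a, (linearMPCA ℓ R).IsFeasible a) ↔
        ∃ π : Equiv.Perm (Fin N), matchingCost (assignmentCost ℓ R) π < ∞) ∧
      (∀ π : Equiv.Perm (Fin N),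
        (linearMPCA ℓ R).IsOptimal (singleChannel ℓ R fun m => π (Fin.castLE hMN m)) ↔
          IsMinCostAssignment (assignmentCost ℓ R) π) ∧
      (∀ a : Allocation M N, (linearMPCA ℓ R).IsOptimal a →
        ENNReal.ofReal a.totalPower =
          ⨅ π : Equiv.Perm (Fin N), matchingCost (assignmentCost ℓ R) π) := by
  refine ⟨Solver.solvableInPolyTime, fun M N hMN ℓ R hℓ hR => ⟨fun a ha => ?_, ?_, ?_, ?_, ?_⟩⟩
  · exact ⟨ha.exists_best hR, fun σ hσ => ha.singleChannel hR hℓ hσ⟩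
  · exact exists_isOptimal_singleChannel hR hℓ
  · exact exists_isFeasible_iff hMN hR hℓ
  · exact isOptimal_iff_isMinCostAssignment hMN hR hℓ
  · exact fun a ha => ofReal_totalPower_eq hMN hR hℓ ha
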